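/- Let $X$ be a compact complex manifold of dimension $s+m$, let $Y$ be a complex manifold of dimension $m$ (both Hausdorff), and let $\pi\colon X\to Y$ be a compact fibration, i.e. a surjective holomorphic submersion. Hermitian metrics are understood to be $C^\infty$. For a Hermitian metric $\sum g_{i\bar j}\,dz_i\otimes d\bar z_j$ on a complex manifold, put $$R_{i\bar j k\bar l}=-\frac{\partial^2 g_{i\bar j}}{\partial z_k\partial\bar z_l}+\sum_{p,q}g^{p\bar q}\frac{\partial g_{i\bar p}}{\partial z_k}\frac{\partial g_{q\bar j}}{\partial\bar z_l},$$ where $(g^{p\bar q})$ is the inverse matrix of $(g_{i\bar j})$, and call $$K(\xi)=\frac{2\sum_{i,j,k,l} R_{i\bar jk\bar l}\,\xi_i\bar\xi_j\xi_k\bar\xi_l}{\sum_{i,j,k,l} g_{i\bar j}g_{k\bar l}\,\xi_i\bar\xi_j\xi_k\bar\xi_l}$$ the holomorphic sectional curvature in the direction of the non-zero tangent vector $\xi=\sum_i\xi_i\,\partial/\partial z_i$. The metric has positive holomorphic sectional curvature if $K(\xi)>0$ for all non-zero $\xi$ at all points. Assume that $Y$ carries a Hermitian metric $\omega_Y$ of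 positive holomorphic sectional curvature, and that there is a smooth family $\{G_t\}_{t\in Y}$ of Hermitian metrics, $G_t$ on the fiber $\pi^{-1}(t)$, each of positive holomorphic sectional curvature. (Smooth means: in local holomorphic coordinates $(z_1,\dots,z_{s+m})$ on $X$ whose last $m$ members are pulled back from local holomorphic coordinates on $Y$, the functions $G_{\pi(\cdot)}(\partial/\partial z_i,\partial/\partial z_j)$, $1\le i,j\le s$, are $C^\infty$ in $z_1,\dots,z_{s+m}$.) Then $X$ carries a Hermitian metric of positive holomorphic sectional curvature. More precisely, there are Hermitian metrics $\Phi$ on $X$ that induce $G_t$ on $\pi^{-1}(t)$ for every $t\in Y$, and for every such $\Phi$ there is $\lambda_0\in\mathbb R$ such that for all real $\lambda\ge\lambda_0$ the warped product $\Phi+\lambda\,\pi^*\omega_Y$ is a Hermitian metric on $X$ of positive holomorphic sectional curvature. -/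

import Mathlib

open scoped Manifold ContDiff ComplexConjugate

noncomputable section

namespace HermFib

/-- The coordinate space `ℂⁿ`. -/
abbrev Cn (n : ℕ) : Type := EuclideanSpace ℂ (Fin n)

/-- The `i`-th standard basis vector of `ℂⁿ`. -/
def stdVec {n : ℕ} (i : Fin n) : Cn n := EuclideanSpace.single i (1 : ℂ)

/-! ### Curvature of a Hermitian matrix function on (an open subset of) `ℂⁿ` -/

/-- The Wirtinger derivative `∂f/∂z_k = (∂f/∂x_k - √-1 ∂f/∂y_k) / 2`. -/
def dz {n : ℕ} (k : Fin n) (f : Cn n → ℂ) (z : Cn n) : ℂ :=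
  (fderiv ℝ f z (stdVec k) - Complex.I * fderiv ℝ f z (Complex.I • stdVec k)) / 2

/-- The Wirtinger derivative `∂f/∂z̄_k = (∂f/∂x_k + √-1 ∂f/∂y_k) / 2`. -/
def dzbar {n : ℕ} (k : Fin n) (f : Cn n → ℂ) (z : Cn n) : ℂ :=
  (fderiv ℝ f z (stdVec k) + Complex.I * fderiv ℝ f z (Complex.I • stdVec k)) / 2

/-- The component `R_{i j̄ k l̄}` at `z` of the curvature tensor of the metric (Chern) connection of
`∑ g_{i j̄} dz_i ⊗ dz̄_j`:
`R_{i j̄ k l̄} = - ∂²g_{i j̄}/∂z_k∂z̄_l + ∑_{p,q} g^{p q̄} (∂g_{i p̄}/∂z_k) (∂g_{q j̄}/∂z̄_l)`,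
where `(g^{p q̄})` is the inverse matrix of `(g_{i j̄})`. -/
def curv {n : ℕ} (g : Cn n → Matrix (Fin n) (Fin n) ℂ) (z : Cn n) (i j k l : Fin n) : ℂ :=
  - dz k (dzbar l (fun w => g w i j)) z
    + ∑ p, ∑ q, (g z)⁻¹ p q * dz k (fun w => g w i p) z * dzbar l (fun w => g w q j) z

/-- The holomorphic sectional curvature `K(ξ)` at `z` of `∑ g_{i j̄} dz_i ⊗ dz̄_j` in the direction of
`ξ = ∑ ξ_i ∂/∂z_i`:
`K(ξ) = 2 ∑ R_{i j̄ k l̄} ξ_i ξ̄_j ξ_k ξ̄_l / ∑ g_{i j̄} g_{k l̄} ξ_i ξ̄_j ξ_k ξ̄_l`.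
For a smooth Hermitian `g` numerator and denominator are real numbers; the real part only makes the
value a term of type `ℝ`. -/
def holSectCurv {n : ℕ} (g : Cn n → Matrix (Fin n) (Fin n) ℂ) (z ξ : Cn n) : ℝ :=
  ((2 * ∑ i, ∑ j, ∑ k, ∑ l, curv g z i j k l * ξ i * conj (ξ j) * ξ k * conj (ξ l)) /
    (∑ i, ∑ j, ∑ k, ∑ l, g z i j * g z k l * ξ i * conj (ξ j) * ξ k * conj (ξ l))).re

/-! ### Hermitian metrics on complex manifolds -/

section Manifold

variable {n : ℕ} (M : Type*) [TopologicalSpace M] [ChartedSpace (Cn n) M]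

/-- A complex manifold of dimension `n` carries holomorphic coordinate charts: the charts of the
maximal atlas of its complex (analytic) structure. -/
abbrev holoCharts : Set (OpenPartialHomeomorph M (Cn n)) :=
  IsManifold.maximalAtlas 𝓘(ℂ, Cn n) ω M

/-- A field of sesquilinear forms (linear in the first, conjugate-linear in the second variable) on
the holomorphic tangent spaces of a complex manifold, with no smoothness required. -/
abbrev SesqField : Type _ :=
  ∀ x : M, TangentSpace 𝓘(ℂ, Cn n) x →ₗ[ℂ] TangentSpace 𝓘(ℂ, Cn n) x →ₗ⋆[ℂ] ℂ

variable {M}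

/-- The coordinate vector `∂/∂z_i` at the point with coordinates `z` in the chart `φ`. -/
def coordVec (φ : OpenPartialHomeomorph M (Cn n)) (z : Cn n) (i : Fin n) :
    TangentSpace 𝓘(ℂ, Cn n) (φ.symm z) :=
  mfderiv 𝓘(ℂ, Cn n) 𝓘(ℂ, Cn n) φ.symm z (stdVec i)

/-- The coefficients `g_{i j̄} = g(∂/∂z_i, ∂/∂z_j)` in the chart `φ`, as functions of the
coordinates. -/
def coeff (g : SesqField (n := n) M) (φ : OpenPartialHomeomorph M (Cn n)) (z : Cn n) :
    Matrix (Fin n) (Fin n) ℂ :=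
  Matrix.of fun i j => g (φ.symm z) (coordVec φ z i) (coordVec φ z j)

/-- Hermitian metrics: Hermitian, positive definite, with `C^∞` (in the real sense) coefficients in
holomorphic coordinates. -/
structure IsHermitianMetric (g : SesqField (n := n) M) : Prop where
  conj_symm : ∀ x u v, conj (g x u v) = g x v u
  pos : ∀ x u, u ≠ 0 → 0 < (g x u u).re
  smooth : ∀ φ ∈ holoCharts (n := n) M, ∀ i j,
    ContDiffOn ℝ ∞ (fun z => coeff g φ z i j) φ.target

/-- The holomorphic sectional curvature is positive, at all points and in all directions. -/
def HasPosHSC (g : SesqField (n := n) M) : Prop :=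
  ∀ φ ∈ holoCharts (n := n) M, ∀ z ∈ φ.target, ∀ ξ : Cn n, ξ ≠ 0 →
    0 < holSectCurv (coeff g φ) z ξ

end Manifold

/-! ### Fibrations, and families of metrics on their fibers

The total space `X` has dimension `s + m`, the base `Y` has dimension `m`, the fibers have
dimension `s`. -/

section Fibration

variable {s m : ℕ} {X Y : Type*} [TopologicalSpace X] [ChartedSpace (Cn (s + m)) X]
  [TopologicalSpace Y] [ChartedSpace (Cn m) Y]

/-- The differential of `π` at `x`. -/
abbrev dπ (π : X → Y) (x : X) :
    TangentSpace 𝓘(ℂ, Cn (s + m)) x →L[ℂ] TangentSpace 𝓘(ℂ, Cn m) (π x) :=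
  mfderiv 𝓘(ℂ, Cn (s + m)) 𝓘(ℂ, Cn m) π x

/-- A fibration is a surjective holomorphic submersion. -/
structure IsFibration (π : X → Y) : Prop where
  holomorphic : ContMDiff 𝓘(ℂ, Cn (s + m)) 𝓘(ℂ, Cn m) ω π
  surjective : Function.Surjective π
  submersive : ∀ x, Function.Surjective (dπ (s := s) (m := m) π x)

/-- The tangent space at `x` of the fiber of `π` through `x`, as a subspace of the tangent space of
the total space: the kernel of the differential. -/
abbrev vert (π : X → Y) (x : X) : Submodule ℂ (TangentSpace 𝓘(ℂ, Cn (s + m)) x) :=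
  LinearMap.ker (dπ (s := s) (m := m) π x).toLinearMap

/-- The last `m` coordinates `(z_{s+1}, …, z_{s+m})`. -/
def lastCoords (s m : ℕ) (z : Cn (s + m)) : Cn m := WithLp.toLp 2 fun α => z (Fin.natAdd s α)

/-- The point `(w, c)` of `ℂ^(s+m)` with first coordinates `w` and last coordinates `c`. -/
def join {s m : ℕ} (w : Cn s) (c : Cn m) : Cn (s + m) := WithLp.toLp 2 (Fin.append w c)

/-- Holomorphic coordinates `(z_1, …, z_{s+m})` on `X` (the chart `φ`) adapted to `π`: the last `m`
of them are the pull-back of holomorphic coordinates on `Y` (the chart `χ`). On each fiber of `π`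
the remaining `(z_1, …, z_s)` are then local holomorphic coordinates of the fiber. -/
structure IsAdapted (π : X → Y) (φ : OpenPartialHomeomorph X (Cn (s + m)))
    (χ : OpenPartialHomeomorph Y (Cn m)) : Prop where
  left_mem : φ ∈ holoCharts (n := s + m) X
  right_mem : χ ∈ holoCharts (n := m) Y
  maps : ∀ x ∈ φ.source, π x ∈ χ.source
  last_eq : ∀ x ∈ φ.source, χ (π x) = lastCoords s m (φ x)

/-- The coordinate vectors `∂/∂z_1, …, ∂/∂z_s` of adapted coordinates are tangent to the fibers. -/
theorem IsAdapted.coordVec_mem [IsManifold 𝓘(ℂ, Cn (s + m)) ω X] [IsManifold 𝓘(ℂ, Cn m) ω Y]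
    {π : X → Y} {φ : OpenPartialHomeomorph X (Cn (s + m))} {χ : OpenPartialHomeomorph Y (Cn m)}
    (h : IsAdapted π φ χ) {z : Cn (s + m)} (hz : z ∈ φ.target) (i : Fin s) :
    coordVec φ z (Fin.castAdd m i) ∈ vert (s := s) (m := m) π (φ.symm z) := by
  have hx : φ.symm z ∈ φ.source := φ.map_target hz
  let P : Cn (s + m) →L[ℂ] Cn m := LinearMap.toContinuousLinearMap
    { toFun := lastCoords s m, map_add' := fun _ _ => rfl, map_smul' := fun _ _ => rfl }
  have hP : Differentiable ℂ (lastCoords s m) := P.differentiable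
  have hφs : MDifferentiableAt 𝓘(ℂ, Cn (s + m)) 𝓘(ℂ, Cn (s + m)) φ.symm z :=
    mdifferentiableAt_symm_of_mem_maximalAtlas
      (IsManifold.maximalAtlas_subset_of_le le_top h.left_mem) hz
  have hφ : MDifferentiableAt 𝓘(ℂ, Cn (s + m)) 𝓘(ℂ, Cn (s + m)) φ (φ.symm z) :=
    mdifferentiableAt_of_mem_maximalAtlas
      (IsManifold.maximalAtlas_subset_of_le le_top h.left_mem) hx
  have hPz : lastCoords s m z = χ (π (φ.symm z)) := by
    rw [h.last_eq _ hx, φ.right_inv hz]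
  have hzt : lastCoords s m z ∈ χ.target := hPz ▸ χ.map_source (h.maps _ hx)
  have hχs : MDifferentiableAt 𝓘(ℂ, Cn m) 𝓘(ℂ, Cn m) χ.symm (lastCoords s m z) :=
    mdifferentiableAt_symm_of_mem_maximalAtlas
      (IsManifold.maximalAtlas_subset_of_le le_top h.right_mem) hzt
  have hPm : MDifferentiableAt 𝓘(ℂ, Cn (s + m)) 𝓘(ℂ, Cn m) (lastCoords s m) z :=
    (hP z).mdifferentiableAt
  have hπe : π =ᶠ[nhds (φ.symm z)] (χ.symm ∘ lastCoords s m) ∘ φ := by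
    filter_upwards [φ.open_source.mem_nhds hx] with x hxs
    simp only [Function.comp_apply]
    rw [← h.last_eq x hxs, χ.left_inv (h.maps x hxs)]
  have hcomp : MDifferentiableAt 𝓘(ℂ, Cn (s + m)) 𝓘(ℂ, Cn m) (χ.symm ∘ lastCoords s m) z :=
    hχs.comp z hPm
  have hπ : MDifferentiableAt 𝓘(ℂ, Cn (s + m)) 𝓘(ℂ, Cn m) π (φ.symm z) := by
    refine MDifferentiableAt.congr_of_eventuallyEq ?_ hπe
    refine MDifferentiableAt.comp _ ?_ hφ
    rw [φ.right_inv hz]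
    exact hcomp
  have hπs : π ∘ φ.symm =ᶠ[nhds z] χ.symm ∘ lastCoords s m := by
    filter_upwards [φ.open_target.mem_nhds hz] with y hy
    have hy' := φ.map_target hy
    simp only [Function.comp_apply]
    rw [← χ.left_inv (h.maps _ hy'), h.last_eq _ hy', φ.right_inv hy]
  have h4 : mfderiv 𝓘(ℂ, Cn (s + m)) 𝓘(ℂ, Cn m) (lastCoords s m) z
      (stdVec (Fin.castAdd m i)) = 0 := by
    rw [mfderiv_eq_fderiv]
    change fderiv ℂ P z _ = 0
    rw [P.fderiv]
    change lastCoords s m _ = 0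
    ext α
    have hne : Fin.natAdd s α ≠ Fin.castAdd m i := by
      simp only [ne_eq, Fin.ext_iff, Fin.val_natAdd, Fin.val_castAdd]
      omega
    simp [lastCoords, stdVec, hne]
  have h5 : mfderiv 𝓘(ℂ, Cn (s + m)) 𝓘(ℂ, Cn m) (π ∘ φ.symm) z
      (stdVec (Fin.castAdd m i)) = 0 := by
    rw [hπs.mfderiv_eq, mfderiv_comp z hχs hPm]
    change mfderiv 𝓘(ℂ, Cn m) 𝓘(ℂ, Cn m) χ.symm (lastCoords s m z)
      (mfderiv 𝓘(ℂ, Cn (s + m)) 𝓘(ℂ, Cn m) (lastCoords s m) z (stdVec (Fin.castAdd m i))) = 0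
    rw [h4, map_zero]
  rw [mfderiv_comp z hπ hφs] at h5
  exact h5

variable [IsManifold 𝓘(ℂ, Cn (s + m)) ω X] [IsManifold 𝓘(ℂ, Cn m) ω Y]

/-- A family `{G_t}` of fields of sesquilinear forms on the fibers of `π`: the form `G x` lives on
the tangent space at `x` of the fiber through `x`, and `G_t` consists of the `G x` with `π x = t`. -/
abbrev FiberField (π : X → Y) : Type _ :=
  ∀ x : X, vert (s := s) (m := m) π x →ₗ[ℂ] vert (s := s) (m := m) π x →ₗ⋆[ℂ] ℂ

open Classical in
/-- The coefficients `G(∂/∂z_i, ∂/∂z_j)`, `i, j ≤ s`, in adapted coordinates, as functions of all the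
coordinates `z_1, …, z_{s+m}` (with value `0` outside the coordinate domain). -/
def fiberCoeff {π : X → Y} (G : FiberField (s := s) (m := m) π)
    {φ : OpenPartialHomeomorph X (Cn (s + m))} {χ : OpenPartialHomeomorph Y (Cn m)}
    (h : IsAdapted π φ χ) (z : Cn (s + m)) : Matrix (Fin s) (Fin s) ℂ :=
  Matrix.of fun i j =>
    if hz : z ∈ φ.target then
      G (φ.symm z) ⟨coordVec φ z (Fin.castAdd m i), h.coordVec_mem hz i⟩
        ⟨coordVec φ z (Fin.castAdd m j), h.coordVec_mem hz j⟩
    else 0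

/-- A smooth family of Hermitian metrics on the fibers of `π`: Hermitian and positive definite on
the tangent spaces of the fibers, with coefficients that are `C^∞` in all variables, those along
the fibers and those of the base. -/
structure IsSmoothHermitianFamily {π : X → Y} (G : FiberField (s := s) (m := m) π) : Prop where
  conj_symm : ∀ x u v, conj (G x u v) = G x v u
  pos : ∀ x u, u ≠ 0 → 0 < (G x u u).re
  smooth : ∀ (φ : OpenPartialHomeomorph X (Cn (s + m))) (χ : OpenPartialHomeomorph Y (Cn m))
    (h : IsAdapted π φ χ) (i j : Fin s),
    ContDiffOn ℝ ∞ (fun z => fiberCoeff G h z i j) φ.target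

/-- Each metric of the family has positive holomorphic sectional curvature on its fiber: in adapted
coordinates, with the base coordinates `c` frozen, the matrix function `w ↦ G(∂/∂z_i, ∂/∂z_j)(w, c)`
of the fiber coordinates `w` has positive holomorphic sectional curvature. -/
def FibersHavePosHSC {π : X → Y} (G : FiberField (s := s) (m := m) π) : Prop :=
  ∀ (φ : OpenPartialHomeomorph X (Cn (s + m))) (χ : OpenPartialHomeomorph Y (Cn m))
    (h : IsAdapted π φ χ) (w : Cn s) (c : Cn m), join w c ∈ φ.target →
    ∀ ξ : Cn s, ξ ≠ 0 → 0 < holSectCurv (fun w' => fiberCoeff G h (join w' c)) w ξ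

/-- The forms `Φ` on the total space induce the family `G` on the fibers. -/
def Induces {π : X → Y} (Φ : SesqField (n := s + m) X) (G : FiberField (s := s) (m := m) π) :
    Prop :=
  ∀ (x : X) (u v : vert (s := s) (m := m) π x), Φ x u v = G x u v

/-- The pull-back `π^* h`. -/
def pullback (π : X → Y) (h : SesqField (n := m) Y) : SesqField (n := s + m) X :=
  fun x => ((h (π x)).compl₂ (dπ (s := s) (m := m) π x).toLinearMap).comp
    (dπ (s := s) (m := m) π x).toLinearMap

/-- The warped product form `Φ + r π^* h`. -/
def warped (π : X → Y) (Φ : SesqField (n := s + m) X) (r : ℝ) (h : SesqField (n := m) Y) :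
    SesqField (n := s + m) X :=
  fun x => Φ x + (r : ℂ) • pullback (s := s) π h x

end Fibration

end HermFib

end

/-!
The proof rests on a description of the holomorphic sectional curvature that makes no use of the
curvature tensor. Put `F(z, v) = g_z(v, v)`, a function on the tangent bundle, which is itself a
complex manifold. A tangent vector of it at `(z, ξ)` that lifts `ξ` has the form `(ξ, η)`.
Completing the square gives
`levi F (z, ξ) (ξ, η) + ∑ R_{i j̄ k l̄} ξ_i ξ̄_j ξ_k ξ̄_l = g_z(η - η₀, η - η₀)`,
where `η₀` (`geodesicAccel`) depends smoothly on `(z, ξ)` (`IsHermMatrixOn.levi_add_curvForm`).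
Hence the curvature in the direction `ξ` is positive if and only if the Levi form of `F` at
`(z, ξ)` is negative on *some* lift of `ξ` (`IsHermMatrixOn.holSectCurv_pos_iff_exists`).
As Levi forms are invariant under holomorphic maps (`levi_comp`), in particular under tangent maps
of holomorphic maps, this criterion is independent of the chart
(`IsHermitianMetric.holSectCurv_pos_of_chart`), and it behaves well under restriction to fibers and
under pull-back from the base.

In coordinates adapted to `π`, which exist by the inverse function theorem
(`IsFibration.exists_isAdapted`), the Levi form of `Φ + r π^*ω_Y` on a lift `(ξ, η)` is `A + r B`,
where `A` belongs to `Φ` and `B` is the Levi form of `ω_Y` on the last components of `(ξ, η)`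
(`levi_warped`). Let the last component of `η` be the vector `η₀` of `ω_Y`. Then `B ≤ 0`, with
`B < 0` unless `ξ` is vertical; and for vertical `ξ` the last component of `η` vanishes, so that `A`
is a Levi form on the fiber (`levi_fiber`), which is negative if the first component of `η` is
suitable. By continuity `A + r B < 0` near a given `(z, ξ)` for all large `r`
(`eventually_exists_levi_neg`), and compactness of the unit sphere and of `X` gives a bound for `r`
that is uniform (`eventually_warped_hasPosHSC`).

A metric `Φ` inducing the given family is glued by a partition of unity from the direct sums, in
adapted coordinates, of the metrics of the fibers and a flat metric
(`IsSmoothHermitianFamily.exists_isHermitianMetric_induces`).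
-/

noncomputable section

namespace HermFib

/-! ### The Levi form of a function -/

section Levi

open Complex

variable {E E' : Type*} [NormedAddCommGroup E] [NormedSpace ℂ E] [NormedSpace ℝ E]
  [IsScalarTower ℝ ℂ E] [NormedAddCommGroup E'] [NormedSpace ℂ E'] [NormedSpace ℝ E']
  [IsScalarTower ℝ ℂ E']

/-- The Levi form `∂∂̄F(w, w̄)` of `F` at `p`, written with the real second derivative:
it equals `(D²F(w, w) + D²F(iw, iw)) / 4`. -/
def levi (F : E → ℂ) (p w : E) : ℂ :=
  (fderiv ℝ (fderiv ℝ F) p w w + fderiv ℝ (fderiv ℝ F) p (I • w) (I • w)) / 4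

/-- The derivative of `F` of type `(1, 0)` in the direction `w`. -/
def wirt (w : E) (F : E → ℂ) (p : E) : ℂ :=
  (fderiv ℝ F p w - I * fderiv ℝ F p (I • w)) / 2

/-- The derivative of `F` of type `(0, 1)` in the direction `w`. -/
def wirtBar (w : E) (F : E → ℂ) (p : E) : ℂ :=
  (fderiv ℝ F p w + I * fderiv ℝ F p (I • w)) / 2

omit [NormedSpace ℂ E] [IsScalarTower ℝ ℂ E] [NormedSpace ℂ E'] [IsScalarTower ℝ ℂ E'] in
theorem fderiv_fderiv_comp_apply {F : E' → ℂ} {Ψ : E → E'} {p : E}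
    (hF : ContDiffAt ℝ 2 F (Ψ p)) (hΨ : ContDiffAt ℝ 2 Ψ p) (u v : E) :
    fderiv ℝ (fderiv ℝ (F ∘ Ψ)) p u v =
      fderiv ℝ (fderiv ℝ F) (Ψ p) (fderiv ℝ Ψ p u) (fderiv ℝ Ψ p v)
        + fderiv ℝ F (Ψ p) (fderiv ℝ (fderiv ℝ Ψ) p u v) := by
  have h1 : fderiv ℝ (F ∘ Ψ) =ᶠ[nhds p]
      fun q => (fderiv ℝ F (Ψ q)).comp (fderiv ℝ Ψ q) := by
    have hF' := hΨ.continuousAt.eventually (hF.eventually (by simp))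
    filter_upwards [hF', hΨ.eventually (by simp)] with q hq1 hq2
    exact fderiv_comp q (hq1.differentiableAt (by simp)) (hq2.differentiableAt (by simp))
  have hdF : DifferentiableAt ℝ (fderiv ℝ F) (Ψ p) :=
    (hF.fderiv_right (m := 1) (by norm_num)).differentiableAt (by simp)
  have hdΨ : DifferentiableAt ℝ (fderiv ℝ Ψ) p :=
    (hΨ.fderiv_right (m := 1) (by norm_num)).differentiableAt (by simp)
  have h2 : HasFDerivAt (fun q => fderiv ℝ F (Ψ q))
      ((fderiv ℝ (fderiv ℝ F) (Ψ p)).comp (fderiv ℝ Ψ p)) p :=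
    hdF.hasFDerivAt.comp p (hΨ.differentiableAt (by simp)).hasFDerivAt
  rw [h1.fderiv_eq, (h2.clm_comp hdΨ.hasFDerivAt).fderiv]
  simp [add_comm]

theorem fderiv_fderiv_restrictScalars {Ψ : E → E'} {p : E} (hΨ : ContDiffAt ℂ 2 Ψ p) (u v : E) :
    fderiv ℝ (fderiv ℝ Ψ) p u v = fderiv ℂ (fderiv ℂ Ψ) p u v := by
  have h1 : fderiv ℝ Ψ =ᶠ[nhds p] fun q => (fderiv ℂ Ψ q).restrictScalars ℝ := by
    filter_upwards [hΨ.eventually (by simp)] with q hq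
    exact (hq.differentiableAt (by simp)).fderiv_restrictScalars ℝ
  have hd : DifferentiableAt ℂ (fderiv ℂ Ψ) p :=
    (hΨ.fderiv_right (m := 1) (by norm_num)).differentiableAt (by simp)
  have h2 : HasFDerivAt (fun q => (fderiv ℂ Ψ q).restrictScalars ℝ)
      ((ContinuousLinearMap.restrictScalarsL ℂ E E' ℝ ℝ).comp
        ((fderiv ℂ (fderiv ℂ Ψ) p).restrictScalars ℝ)) p :=
    (ContinuousLinearMap.restrictScalarsL ℂ E E' ℝ ℝ).hasFDerivAt.comp p
      (hd.hasFDerivAt.restrictScalars ℝ)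
  rw [h1.fderiv_eq, h2.fderiv]
  simp

/-- The Levi form is invariant under holomorphic maps: the second derivative of the map enters
through its values on `(w, w)` and `(iw, iw)`, which are opposite. -/
theorem levi_comp {F : E' → ℂ} {Ψ : E → E'} {p : E}
    (hF : ContDiffAt ℝ 2 F (Ψ p)) (hΨ : ContDiffAt ℂ 2 Ψ p) (w : E) :
    levi (F ∘ Ψ) p w = levi F (Ψ p) (fderiv ℂ Ψ p w) := by
  have hr : ContDiffAt ℝ 2 Ψ p := hΨ.restrict_scalars ℝ
  have h1 : fderiv ℝ Ψ p = (fderiv ℂ Ψ p).restrictScalars ℝ :=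
    (hΨ.differentiableAt (by simp)).fderiv_restrictScalars ℝ
  simp only [levi, fderiv_fderiv_comp_apply hF hr, fderiv_fderiv_restrictScalars hΨ, h1]
  simp only [ContinuousLinearMap.coe_restrictScalars', map_smul, smul_apply,
    smul_smul, I_mul_I, neg_smul, one_smul, map_neg]
  ring

omit [IsScalarTower ℝ ℂ E] in
theorem levi_congr {F F' : E → ℂ} {p : E} (h : F =ᶠ[nhds p] F') (w : E) :
    levi F p w = levi F' p w := by
  have h2 : fderiv ℝ F =ᶠ[nhds p] fderiv ℝ F' := h.fderiv
  simp only [levi, h2.fderiv_eq]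

omit [IsScalarTower ℝ ℂ E] in
theorem levi_add {F F' : E → ℂ} {p : E} (hF : ContDiffAt ℝ 2 F p) (hF' : ContDiffAt ℝ 2 F' p)
    (w : E) : levi (fun q => F q + F' q) p w = levi F p w + levi F' p w := by
  have h1 : fderiv ℝ (fun q => F q + F' q) =ᶠ[nhds p] fun q => fderiv ℝ F q + fderiv ℝ F' q := by
    filter_upwards [hF.eventually (by simp), hF'.eventually (by simp)] with q h h'
    exact fderiv_fun_add (h.differentiableAt (by simp)) (h'.differentiableAt (by simp))
  have hd {F : E → ℂ} (hF : ContDiffAt ℝ 2 F p) : DifferentiableAt ℝ (fderiv ℝ F) p :=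
    (hF.fderiv_right (m := 1) (by norm_num)).differentiableAt (by simp)
  simp only [levi, h1.fderiv_eq, fderiv_fun_add (hd hF) (hd hF')]
  simp only [add_apply]
  ring

omit [IsScalarTower ℝ ℂ E] in
theorem levi_const_mul {F : E → ℂ} {p : E} (hF : ContDiffAt ℝ 2 F p) (c : ℂ)
    (w : E) : levi (fun q => c * F q) p w = c * levi F p w := by
  have h1 : fderiv ℝ (fun q => c * F q) =ᶠ[nhds p] fun q => c • fderiv ℝ F q := by
    filter_upwards [hF.eventually (by simp)] with q h
    exact fderiv_const_mul (h.differentiableAt (by simp)) c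
  have hd : DifferentiableAt ℝ (fderiv ℝ F) p :=
    (hF.fderiv_right (m := 1) (by norm_num)).differentiableAt (by simp)
  simp only [levi, h1.fderiv_eq, fderiv_fun_const_smul hd]
  simp only [smul_apply, smul_eq_mul]
  ring

omit [IsScalarTower ℝ ℂ E] in
theorem levi_sum {ι : Type*} {s : Finset ι} {F : ι → E → ℂ} {p : E}
    (hF : ∀ i, ContDiffAt ℝ 2 (F i) p) (w : E) :
    levi (fun q => ∑ i ∈ s, F i q) p w = ∑ i ∈ s, levi (F i) p w := by
  classical
  induction s using Finset.induction_on with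
  | empty => simp [levi]
  | insert i s hi ih =>
    simp only [Finset.sum_insert hi]
    rw [levi_add (hF i) (ContDiffAt.sum fun j _ => hF j), ih]

omit [IsScalarTower ℝ ℂ E] in
/-- The Levi form as an iterated Wirtinger derivative. -/
theorem levi_eq_wirt_wirtBar {F : E → ℂ} {p : E} (hF : ContDiffAt ℝ 2 F p) (w : E) :
    levi F p w = wirt w (wirtBar w F) p := by
  have hd : DifferentiableAt ℝ (fderiv ℝ F) p :=
    (hF.fderiv_right (m := 1) (by norm_num)).differentiableAt (by simp)
  have hsymm : IsSymmSndFDerivAt ℝ F p := hF.isSymmSndFDerivAt (by simp)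
  have h1 (u : E) : fderiv ℝ (wirtBar w F) p u =
      (fderiv ℝ (fderiv ℝ F) p u w + I * fderiv ℝ (fderiv ℝ F) p u (I • w)) / 2 := by
    have ha (v : E) : HasFDerivAt (fun q => fderiv ℝ F q v)
        ((fderiv ℝ (fderiv ℝ F) p).flip v) p := by
      simpa using! hd.hasFDerivAt.clm_apply (hasFDerivAt_const v p)
    have hb := ((ha w).add ((ha (I • w)).const_mul I)).mul_const (2⁻¹ : ℂ)
    have hc : wirtBar w F = fun q =>
        (fderiv ℝ F q w + I * fderiv ℝ F q (I • w)) * (2⁻¹ : ℂ) := by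
      ext q; simp [wirtBar, div_eq_mul_inv]
    have hb' : HasFDerivAt (wirtBar w F) ((2⁻¹ : ℂ) • ((fderiv ℝ (fderiv ℝ F) p).flip w
        + I • (fderiv ℝ (fderiv ℝ F) p).flip (I • w))) p := by rw [hc]; exact hb
    rw [hb'.fderiv]
    simp only [add_apply, smul_apply, smul_eq_mul, ContinuousLinearMap.flip_apply]
    ring
  rw [wirt, h1, h1, levi, hsymm w (I • w)]
  ring_nf
  simp only [I_sq]
  ring

omit [IsScalarTower ℝ ℂ E] in
theorem continuousAt_re_levi {P : Type*} [TopologicalSpace P] {F : E → ℂ} {f u : P → E} {x : P}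
    (hF : ContDiffAt ℝ 2 F (f x)) (hf : ContinuousAt f x) (hu : ContinuousAt u x) :
    ContinuousAt (fun y => (levi F (f y) (u y)).re) x := by
  have hc : ContinuousAt (fun y => fderiv ℝ (fderiv ℝ F) (f y)) x :=
    ContinuousAt.comp (f := f) ((hF.fderiv_right (m := 1) (by norm_num)).fderiv_right (m := 0)
      (by norm_num)).continuousAt hf
  have hI : ContinuousAt (fun y => I • u y) x := hu.const_smul I
  exact Complex.continuous_re.continuousAt.comp
    ((((hc.clm_apply hu).clm_apply hu).add ((hc.clm_apply hI).clm_apply hI)).div_const 4)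

end Levi

/-! ### Wirtinger derivatives -/

section Wirtinger

open Complex

variable {E : Type*} [NormedAddCommGroup E] [NormedSpace ℂ E] [NormedSpace ℝ E]

theorem wirt_add {F F' : E → ℂ} {p : E} (w : E) (hF : DifferentiableAt ℝ F p)
    (hF' : DifferentiableAt ℝ F' p) :
    wirt w (fun q => F q + F' q) p = wirt w F p + wirt w F' p := by
  simp only [wirt, fderiv_fun_add hF hF', add_apply]
  ring

theorem wirt_mul {F F' : E → ℂ} {p : E} (w : E) (hF : DifferentiableAt ℝ F p)
    (hF' : DifferentiableAt ℝ F' p) :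
    wirt w (fun q => F q * F' q) p = wirt w F p * F' p + F p * wirt w F' p := by
  simp only [wirt, fderiv_fun_mul hF hF', add_apply, smul_apply, smul_eq_mul]
  ring

theorem wirtBar_mul {F F' : E → ℂ} {p : E} (w : E) (hF : DifferentiableAt ℝ F p)
    (hF' : DifferentiableAt ℝ F' p) :
    wirtBar w (fun q => F q * F' q) p = wirtBar w F p * F' p + F p * wirtBar w F' p := by
  simp only [wirtBar, fderiv_fun_mul hF hF', add_apply, smul_apply, smul_eq_mul]
  ring

theorem differentiableAt_wirtBar {f : E → ℂ} {z : E} (hf : ContDiffAt ℝ 2 f z) (w : E) :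
    DifferentiableAt ℝ (wirtBar w f) z := by
  have hd : DifferentiableAt ℝ (fderiv ℝ f) z :=
    (hf.fderiv_right (m := 1) (by norm_num)).differentiableAt (by simp)
  unfold wirtBar
  fun_prop

theorem wirt_const (w : E) (c : ℂ) (p : E) : wirt w (fun _ => c) p = 0 := by
  simp [wirt]

theorem wirt_sum {ι : Type*} {s : Finset ι} {F : ι → E → ℂ} {p : E} (w : E)
    (hF : ∀ i, DifferentiableAt ℝ (F i) p) :
    wirt w (fun q => ∑ i ∈ s, F i q) p = ∑ i ∈ s, wirt w (F i) p := by
  simp only [wirt, fderiv_fun_sum fun i _ => hF i, sum_apply, Finset.mul_sum,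
    ← Finset.sum_sub_distrib, Finset.sum_div]

theorem wirt_congr {F F' : E → ℂ} {p : E} (w : E) (h : F =ᶠ[nhds p] F') :
    wirt w F p = wirt w F' p := by
  simp only [wirt, h.fderiv_eq]

theorem wirtBar_congr {F F' : E → ℂ} {p : E} (w : E) (h : F =ᶠ[nhds p] F') :
    wirtBar w F p = wirtBar w F' p := by
  simp only [wirtBar, h.fderiv_eq]

omit [NormedSpace ℂ E] in
theorem fderiv_conj_comp {F : E → ℂ} {p : E} (hF : DifferentiableAt ℝ F p) (w : E) :
    fderiv ℝ (fun q => conj (F q)) p w = conj (fderiv ℝ F p w) := by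
  have h : HasFDerivAt (fun q => conj (F q))
      (conjCLE.toContinuousLinearMap.comp (fderiv ℝ F p)) p :=
    conjCLE.toContinuousLinearMap.hasFDerivAt.comp p hF.hasFDerivAt
  rw [h.fderiv]; rfl

theorem wirtBar_conj {F : E → ℂ} {p : E} (hF : DifferentiableAt ℝ F p) (w : E) :
    wirtBar w (fun q => conj (F q)) p = conj (wirt w F p) := by
  simp [wirt, wirtBar, fderiv_conj_comp hF, sub_eq_add_neg, map_ofNat (starRingEnd ℂ) 2]

theorem wirt_conj {F : E → ℂ} {p : E} (hF : DifferentiableAt ℝ F p) (w : E) :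
    wirt w (fun q => conj (F q)) p = conj (wirtBar w F p) := by
  simp [wirt, wirtBar, fderiv_conj_comp hF, sub_eq_add_neg, map_ofNat (starRingEnd ℂ) 2]

variable [IsScalarTower ℝ ℂ E]

theorem wirt_clm (b : E →L[ℂ] ℂ) (w p : E) : wirt w (fun q => b q) p = b w := by
  have h : fderiv ℝ (fun q => b q) p = b.restrictScalars ℝ := (b.restrictScalars ℝ).fderiv
  simp only [wirt, h, ContinuousLinearMap.coe_restrictScalars', map_smul, smul_eq_mul]
  linear_combination (-(b w) / 2) * I_mul_I

theorem wirtBar_clm (b : E →L[ℂ] ℂ) (w p : E) : wirtBar w (fun q => b q) p = 0 := by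
  have h : fderiv ℝ (fun q => b q) p = b.restrictScalars ℝ := (b.restrictScalars ℝ).fderiv
  simp only [wirtBar, h, ContinuousLinearMap.coe_restrictScalars', map_smul, smul_eq_mul]
  linear_combination ((b w) / 2) * I_mul_I

omit [NormedSpace ℝ E] [IsScalarTower ℝ ℂ E] in
theorem smul_eq_re_im [Module ℝ E] [IsScalarTower ℝ ℂ E] (c : ℂ) (w : E) :
    c • w = c.re • w + c.im • (I • w) := by
  have h (r : ℝ) (x : E) : r • x = (r : ℂ) • x := by
    rw [← one_smul ℂ x, ← smul_assoc, smul_smul, real_smul]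
  rw [h, h, smul_smul, ← add_smul, re_add_im]

theorem wirt_smul_left (c : ℂ) (w : E) (F : E → ℂ) (p : E) : wirt (c • w) F p = c * wirt w F p := by
  have h2 : I • c • w = (-c.im) • w + c.re • (I • w) := by
    rw [smul_smul, smul_eq_re_im]; simp
  rw [wirt, h2, smul_eq_re_im c w]
  simp only [wirt, map_add, map_smul, real_smul]
  conv_rhs => rw [← re_add_im c]
  push_cast
  linear_combination ((c.im : ℂ) * fderiv ℝ F p (I • w) / 2) * I_mul_I

theorem wirtBar_smul_left (c : ℂ) (w : E) (F : E → ℂ) (p : E) :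
    wirtBar (c • w) F p = conj c * wirtBar w F p := by
  have h2 : I • c • w = (-c.im) • w + c.re • (I • w) := by
    rw [smul_smul, smul_eq_re_im]; simp
  rw [wirtBar, h2, smul_eq_re_im c w]
  simp only [wirtBar, map_add, map_smul, real_smul]
  conv_rhs => rw [← re_add_im c]
  simp only [map_add, map_mul, conj_ofReal, conj_I]
  push_cast
  linear_combination ((c.im : ℂ) * fderiv ℝ F p (I • w) / 2) * I_mul_I

omit [IsScalarTower ℝ ℂ E] in
theorem wirt_sum_left {ι : Type*} (s : Finset ι) (w : ι → E) (F : E → ℂ) (p : E) :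
    wirt (∑ i ∈ s, w i) F p = ∑ i ∈ s, wirt (w i) F p := by
  simp only [wirt, Finset.smul_sum, map_sum, Finset.mul_sum, ← Finset.sum_sub_distrib,
    Finset.sum_div]

omit [IsScalarTower ℝ ℂ E] in
theorem wirtBar_sum_left {ι : Type*} (s : Finset ι) (w : ι → E) (F : E → ℂ) (p : E) :
    wirtBar (∑ i ∈ s, w i) F p = ∑ i ∈ s, wirtBar (w i) F p := by
  simp only [wirtBar, Finset.smul_sum, map_sum, Finset.mul_sum, ← Finset.sum_add_distrib,
    Finset.sum_div]

/-- The Levi form of a function times a linear and a conjugate-linear form. -/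
theorem levi_mul_clm_mul_conj_clm {A : E → ℂ} {p : E} (hA : ContDiffAt ℝ 2 A p)
    (b c : E →L[ℂ] ℂ) (w : E) :
    levi (fun q => A q * b q * conj (c q)) p w =
      wirt w (wirtBar w A) p * b p * conj (c p) + wirtBar w A p * b w * conj (c p)
        + wirt w A p * b p * conj (c w) + A p * b w * conj (c w) := by
  have hb (p) : DifferentiableAt ℝ (fun q => b q) p := (b.restrictScalars ℝ).differentiableAt
  have hc' (p) : DifferentiableAt ℝ (fun q => c q) p := (c.restrictScalars ℝ).differentiableAt
  have hc (p) : DifferentiableAt ℝ (fun q => conj (c q)) p :=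
    conjCLE.differentiableAt.comp p (hc' p)
  have hb2 : ContDiff ℝ 2 (fun q => b q) := (b.restrictScalars ℝ).contDiff
  have hc2 : ContDiff ℝ 2 (fun q => conj (c q)) :=
    conjCLE.contDiff.comp (c.restrictScalars ℝ).contDiff
  have wc (p) : wirt w (fun q => conj (c q)) p = 0 := by
    rw [wirt_conj (hc' p), wirtBar_clm, map_zero]
  have wcb (p) : wirtBar w (fun q => conj (c q)) p = conj (c w) := by
    rw [wirtBar_conj (hc' p), wirt_clm]
  have hdA : DifferentiableAt ℝ A p := hA.differentiableAt (by simp)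
  have hB : DifferentiableAt ℝ (wirtBar w A) p := differentiableAt_wirtBar hA w
  rw [levi_eq_wirt_wirtBar ((hA.mul hb2.contDiffAt).mul hc2.contDiffAt)]
  have h1 : wirtBar w (fun q => A q * b q * conj (c q)) =ᶠ[nhds p]
      fun q => wirtBar w A q * b q * conj (c q) + A q * b q * conj (c w) := by
    filter_upwards [hA.eventually (by simp)] with q hq
    have hd : DifferentiableAt ℝ A q := hq.differentiableAt (by simp)
    rw [wirtBar_mul _ (hd.fun_mul (hb q)) (hc q), wirtBar_mul _ hd (hb q), wirtBar_clm, wcb]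
    ring
  rw [wirt_congr _ h1, wirt_add _ ((hB.fun_mul (hb _)).fun_mul (hc _))
    ((hdA.fun_mul (hb _)).fun_mul (differentiableAt_const _)),
    wirt_mul _ (hB.fun_mul (hb _)) (hc _), wirt_mul _ hB (hb _),
    wirt_mul _ (hdA.fun_mul (hb _)) (differentiableAt_const _), wirt_mul _ hdA (hb _), wirt_clm, wc,
    wirt_const]
  ring

end Wirtinger

section Coordinates

variable {n : ℕ}

theorem sum_smul_stdVec (v : Cn n) : ∑ i, v i • stdVec i = v := by
  ext j
  simp [stdVec, Pi.single_apply]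

theorem dz_eq_wirt (k : Fin n) (f : Cn n → ℂ) : dz k f = wirt (stdVec k) f := rfl

theorem dzbar_eq_wirtBar (k : Fin n) (f : Cn n → ℂ) : dzbar k f = wirtBar (stdVec k) f := rfl

theorem wirt_eq_sum_dz (ξ : Cn n) (f : Cn n → ℂ) (z : Cn n) :
    wirt ξ f z = ∑ k, ξ k * dz k f z := by
  conv_lhs => rw [← sum_smul_stdVec ξ]
  simp only [wirt_sum_left, wirt_smul_left, dz_eq_wirt]

theorem wirtBar_eq_sum_dzbar (ξ : Cn n) (f : Cn n → ℂ) (z : Cn n) :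
    wirtBar ξ f z = ∑ k, conj (ξ k) * dzbar k f z := by
  conv_lhs => rw [← sum_smul_stdVec ξ]
  simp only [wirtBar_sum_left, wirtBar_smul_left, dzbar_eq_wirtBar]

theorem wirt_wirtBar_eq_sum {f : Cn n → ℂ} {z : Cn n} (hf : ContDiffAt ℝ 2 f z) (ξ : Cn n) :
    wirt ξ (wirtBar ξ f) z = ∑ k, ∑ l, ξ k * conj (ξ l) * dz k (dzbar l f) z := by
  have h : wirtBar ξ f = fun q => ∑ l, conj (ξ l) * dzbar l f q := by
    ext q; exact wirtBar_eq_sum_dzbar ξ f q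
  have hd (l) : DifferentiableAt ℝ (dzbar l f) z := differentiableAt_wirtBar hf _
  rw [h, wirt_sum _ fun l => (differentiableAt_const _).fun_mul (hd l), Finset.sum_comm]
  refine Finset.sum_congr rfl fun l _ => ?_
  rw [wirt_mul _ (differentiableAt_const _) (hd l), wirt_const, wirt_eq_sum_dz, Finset.mul_sum,
    zero_mul, zero_add]
  exact Finset.sum_congr rfl fun k _ => by ring

end Coordinates

/-! ### Hermitian matrix functions -/

section Matrix

variable {n : ℕ}

theorem sum_comm_pairs {ι κ : Type*} [Fintype ι] [Fintype κ] (f : ι → ι → κ → κ → ℂ) :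
    ∑ i, ∑ j, ∑ p, ∑ q, f i j p q = ∑ p, ∑ q, ∑ i, ∑ j, f i j p q := by
  have := Finset.sum_comm (s := (Finset.univ : Finset (ι × ι)))
    (t := (Finset.univ : Finset (κ × κ))) (f := fun a b => f a.1 a.2 b.1 b.2)
  simpa only [Fintype.sum_prod_type] using this

/-- The quadratic function `(z, v) ↦ ∑ g_{i j̄}(z) v_i v̄_j` on the tangent bundle `ℂⁿ × ℂⁿ`. -/
def quadForm (g : Cn n → Matrix (Fin n) (Fin n) ℂ) (p : Cn n × Cn n) : ℂ :=
  ∑ i, ∑ j, g p.1 i j * p.2 i * conj (p.2 j)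

/-- `g` is a smooth field of positive definite Hermitian matrices on the open set `U`. -/
structure IsHermMatrixOn (g : Cn n → Matrix (Fin n) (Fin n) ℂ) (U : Set (Cn n)) : Prop where
  isOpen : IsOpen U
  smooth : ∀ i j, ContDiffOn ℝ ∞ (fun z => g z i j) U
  conj_symm : ∀ z ∈ U, ∀ i j, conj (g z i j) = g z j i
  pos : ∀ z ∈ U, ∀ v : Cn n, v ≠ 0 → 0 < (quadForm g (z, v)).re

/-- The curvature form `∑ R_{i j̄ k l̄} ξ_i ξ̄_j ξ_k ξ̄_l`. -/
def curvForm (g : Cn n → Matrix (Fin n) (Fin n) ℂ) (z ξ : Cn n) : ℂ :=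
  ∑ i, ∑ j, ∑ k, ∑ l, curv g z i j k l * ξ i * conj (ξ j) * ξ k * conj (ξ l)

/-- The covector `∂_ξ g(ξ, ·)`, with components `∑_{i,k} (∂g_{i p̄}/∂z_k) ξ_i ξ_k`. -/
def derivCovector (g : Cn n → Matrix (Fin n) (Fin n) ℂ) (z ξ : Cn n) : Fin n → ℂ :=
  fun p => ∑ i, wirt ξ (fun w => g w i p) z * ξ i

/-- The second derivative at `0` of a disc `f` with `f(0) = z`, `f'(0) = ξ` that is geodesic to
second order: the vector dual to `-∂_ξ g(ξ, ·)` under `g`. -/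
def geodesicAccel (g : Cn n → Matrix (Fin n) (Fin n) ℂ) (z ξ : Cn n) : Cn n :=
  -WithLp.toLp 2 (Matrix.vecMul (derivCovector g z ξ) (g z)⁻¹)

theorem geodesicAccel_zero (g : Cn n → Matrix (Fin n) (Fin n) ℂ) (z : Cn n) :
    geodesicAccel g z 0 = 0 := by
  have : derivCovector g z 0 = 0 := by ext; simp [derivCovector]
  simp [geodesicAccel, this]

theorem fderiv_comp_fst {a : Cn n → ℂ} {z v : Cn n} (ha : DifferentiableAt ℝ a z)
    (w : Cn n × Cn n) :
    fderiv ℝ (fun q : Cn n × Cn n => a q.1) (z, v) w = fderiv ℝ a z w.1 := by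
  have h : HasFDerivAt (fun q : Cn n × Cn n => a q.1)
      ((fderiv ℝ a z).comp (ContinuousLinearMap.fst ℝ (Cn n) (Cn n))) (z, v) :=
    HasFDerivAt.comp (f := Prod.fst) (z, v) ha.hasFDerivAt hasFDerivAt_fst
  rw [h.fderiv]; rfl

theorem levi_monomial {a : Cn n → ℂ} {z : Cn n} (ha : ContDiffAt ℝ 2 a z) (ξ η : Cn n)
    (i j : Fin n) :
    levi (fun q : Cn n × Cn n => a q.1 * q.2 i * conj (q.2 j)) (z, ξ) (ξ, η) =
      wirt ξ (wirtBar ξ a) z * ξ i * conj (ξ j) + wirtBar ξ a z * η i * conj (ξ j)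
        + wirt ξ a z * ξ i * conj (η j) + a z * η i * conj (η j) := by
  let b (i : Fin n) : Cn n × Cn n →L[ℂ] ℂ :=
    (EuclideanSpace.proj i).comp (ContinuousLinearMap.snd ℂ (Cn n) (Cn n))
  have hA : ContDiffAt ℝ 2 (fun q : Cn n × Cn n => a q.1) (z, ξ) :=
    ContDiffAt.comp (f := Prod.fst) (z, ξ) ha contDiffAt_fst
  have hda : DifferentiableAt ℝ a z := ha.differentiableAt (by simp)
  have hB : DifferentiableAt ℝ (wirtBar ξ a) z := differentiableAt_wirtBar ha ξ
  have h1 : wirtBar (ξ, η) (fun q : Cn n × Cn n => a q.1) =ᶠ[nhds (z, ξ)]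
      fun q => wirtBar ξ a q.1 := by
    filter_upwards [continuousAt_fst.eventually (ha.eventually (by simp))] with q hq
    have hd : DifferentiableAt ℝ a q.1 := hq.differentiableAt (by simp)
    simp only [wirtBar, fderiv_comp_fst (z := q.1) (v := q.2) hd, Prod.smul_fst]
  refine (levi_mul_clm_mul_conj_clm hA (b i) (b j) (ξ, η)).trans ?_
  rw [wirt_congr _ h1]
  simp only [wirt, fderiv_comp_fst hB, fderiv_comp_fst hda, Prod.smul_fst, h1.eq_of_nhds]
  rfl

namespace IsHermMatrixOn

variable {g : Cn n → Matrix (Fin n) (Fin n) ℂ} {U : Set (Cn n)} {z : Cn n}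

theorem contDiffAt (hg : IsHermMatrixOn g U) (hz : z ∈ U) (i j : Fin n) :
    ContDiffAt ℝ ∞ (fun z => g z i j) z :=
  (hg.smooth i j).contDiffAt (hg.isOpen.mem_nhds hz)

theorem contDiffAt_two (hg : IsHermMatrixOn g U) (hz : z ∈ U) (i j : Fin n) :
    ContDiffAt ℝ 2 (fun z => g z i j) z :=
  (hg.contDiffAt hz i j).of_le (by norm_cast)

theorem contDiffAt_quadForm (hg : IsHermMatrixOn g U) (hz : z ∈ U) (v : Cn n) :
    ContDiffAt ℝ 2 (quadForm g) (z, v) := by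
  have hb2 (i) : ContDiffAt ℝ 2 (fun q : Cn n × Cn n => q.2 i) (z, v) :=
    (((EuclideanSpace.proj i).comp
      (ContinuousLinearMap.snd ℂ (Cn n) (Cn n))).restrictScalars ℝ).contDiff.contDiffAt
  have hA (i j) : ContDiffAt ℝ 2 (fun q : Cn n × Cn n => g q.1 i j) (z, v) :=
    ContDiffAt.comp (f := Prod.fst) (z, v) (hg.contDiffAt_two hz i j) contDiffAt_fst
  exact ContDiffAt.sum fun i _ => ContDiffAt.sum fun j _ => ((hA i j).mul (hb2 i)).mul
    (Complex.conjCLE.contDiff.contDiffAt.comp _ (hb2 j))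

theorem sum_wirtBar (hg : IsHermMatrixOn g U) (hz : z ∈ U) (ξ : Cn n) (q : Fin n) :
    ∑ j, wirtBar ξ (fun w => g w q j) z * conj (ξ j) = conj (derivCovector g z ξ q) := by
  rw [derivCovector, map_sum]
  refine Finset.sum_congr rfl fun j _ => ?_
  rw [map_mul, ← wirtBar_conj ((hg.contDiffAt_two hz j q).differentiableAt (by simp))]
  congr 1
  refine wirtBar_congr _ ?_
  filter_upwards [hg.isOpen.mem_nhds hz] with w hw
  exact (hg.conj_symm w hw j q).symm

theorem levi_quadForm (hg : IsHermMatrixOn g U) (hz : z ∈ U) (ξ η : Cn n) :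
    levi (quadForm g) (z, ξ) (ξ, η) =
      (∑ i, ∑ j, wirt ξ (wirtBar ξ fun w => g w i j) z * ξ i * conj (ξ j))
        + ∑ i, η i * conj (derivCovector g z ξ i) + ∑ j, derivCovector g z ξ j * conj (η j)
        + ∑ i, ∑ j, g z i j * η i * conj (η j) := by
  have hb2 (i) : ContDiffAt ℝ 2 (fun q : Cn n × Cn n => q.2 i) (z, ξ) :=
    (((EuclideanSpace.proj i).comp
      (ContinuousLinearMap.snd ℂ (Cn n) (Cn n))).restrictScalars ℝ).contDiff.contDiffAt
  have hA (i j) : ContDiffAt ℝ 2 (fun q : Cn n × Cn n => g q.1 i j) (z, ξ) :=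
    ContDiffAt.comp (f := Prod.fst) (z, ξ) (hg.contDiffAt_two hz i j) contDiffAt_fst
  have hm (i j) : ContDiffAt ℝ 2
      (fun q : Cn n × Cn n => g q.1 i j * q.2 i * conj (q.2 j)) (z, ξ) :=
    ((hA i j).mul (hb2 i)).mul (Complex.conjCLE.contDiff.contDiffAt.comp _ (hb2 j))
  have h0 : quadForm g = fun q : Cn n × Cn n =>
      ∑ i, ∑ j, g q.1 i j * q.2 i * conj (q.2 j) := rfl
  have h1 (i j) := levi_monomial (hg.contDiffAt_two hz i j) ξ η i j
  rw [h0, levi_sum fun i => ContDiffAt.sum fun j _ => hm i j]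
  simp only [levi_sum (hm _), h1, Finset.sum_add_distrib]
  congr 2
  · congr 1
    refine Finset.sum_congr rfl fun i _ => ?_
    rw [← hg.sum_wirtBar hz, Finset.mul_sum]
    exact Finset.sum_congr rfl fun j _ => by ring
  · rw [Finset.sum_comm]
    simp only [derivCovector, Finset.sum_mul]

theorem det_isUnit (hg : IsHermMatrixOn g U) (hz : z ∈ U) : IsUnit (g z).det := by
  rw [isUnit_iff_ne_zero]
  intro h
  obtain ⟨v, hv, h0⟩ := Matrix.exists_mulVec_eq_zero_iff.2 h
  -- Positivity is tested on the conjugate, as `quadForm` conjugates the second index.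
  have h1 : (WithLp.toLp 2 fun i => conj (v i) : Cn n) ≠ 0 := by
    intro h2
    apply hv
    ext i
    have := congrArg (fun w : Cn n => w i) h2
    simpa using this
  have h2 := hg.pos z hz _ h1
  have h3 : quadForm g (z, WithLp.toLp 2 fun i => conj (v i)) =
      ∑ i, conj (v i) * (g z).mulVec v i := by
    simp only [quadForm, Matrix.mulVec, dotProduct, Finset.mul_sum]
    refine Finset.sum_congr rfl fun i _ => Finset.sum_congr rfl fun j _ => ?_
    simp only [Complex.conj_conj]
    ring
  rw [h3, h0] at h2
  simp at h2

theorem curvForm_eq (hg : IsHermMatrixOn g U) (hz : z ∈ U) (ξ : Cn n) :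
    curvForm g z ξ = -(∑ i, ∑ j, wirt ξ (wirtBar ξ fun w => g w i j) z * ξ i * conj (ξ j))
      + ∑ q, Matrix.vecMul (derivCovector g z ξ) (g z)⁻¹ q * conj (derivCovector g z ξ q) := by
  have h1 (i j) : wirt ξ (wirtBar ξ fun w => g w i j) z * ξ i * conj (ξ j) =
      ∑ k, ∑ l, dz k (dzbar l fun w => g w i j) z * ξ i * conj (ξ j) * ξ k * conj (ξ l) := by
    rw [wirt_wirtBar_eq_sum (hg.contDiffAt_two hz i j)]
    simp only [Finset.sum_mul]
    exact Finset.sum_congr rfl fun k _ => Finset.sum_congr rfl fun l _ => by ring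
  have h2 (i j) : ∑ k, ∑ l, (∑ p, ∑ q, (g z)⁻¹ p q * dz k (fun w => g w i p) z *
        dzbar l (fun w => g w q j) z) * ξ i * conj (ξ j) * ξ k * conj (ξ l) =
      ∑ p, ∑ q, (g z)⁻¹ p q * ((wirt ξ (fun w => g w i p) z * ξ i) *
        (wirtBar ξ (fun w => g w q j) z * conj (ξ j))) := by
    simp only [Finset.sum_mul]
    rw [sum_comm_pairs]
    refine Finset.sum_congr rfl fun p _ => Finset.sum_congr rfl fun q _ => ?_
    rw [mul_mul_mul_comm, wirt_eq_sum_dz, wirtBar_eq_sum_dzbar, Finset.sum_mul_sum, Finset.sum_mul,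
      Finset.mul_sum]
    refine Finset.sum_congr rfl fun k _ => ?_
    rw [Finset.sum_mul, Finset.mul_sum]
    exact Finset.sum_congr rfl fun l _ => by ring
  have h3 : ∑ q, Matrix.vecMul (derivCovector g z ξ) (g z)⁻¹ q * conj (derivCovector g z ξ q) =
      ∑ i, ∑ j, ∑ k, ∑ l, (∑ p, ∑ q, (g z)⁻¹ p q * dz k (fun w => g w i p) z *
        dzbar l (fun w => g w q j) z) * ξ i * conj (ξ j) * ξ k * conj (ξ l) := by
    simp only [h2]
    rw [sum_comm_pairs, Finset.sum_comm]
    -- The `(0, 1)`-derivatives pair to the conjugate covector because `g` is Hermitian.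
    refine Finset.sum_congr rfl fun q _ => ?_
    rw [← hg.sum_wirtBar hz, Matrix.vecMul, dotProduct, Finset.sum_mul]
    refine Finset.sum_congr rfl fun p _ => ?_
    rw [derivCovector, mul_right_comm, Finset.sum_mul_sum, mul_comm, Finset.mul_sum]
    exact Finset.sum_congr rfl fun i _ => Finset.mul_sum _ _ _
  rw [h3, curvForm]
  simp only [h1, curv, add_mul, neg_mul, Finset.sum_add_distrib, Finset.sum_neg_distrib]

/-- Completing the square: the curvature form is the maximum of minus the Levi form of
`(z, v) ↦ g(v, v)` over the lifts `(ξ, η)` of `ξ`, attained at the geodesic acceleration. -/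
theorem levi_add_curvForm (hg : IsHermMatrixOn g U) (hz : z ∈ U) (ξ η : Cn n) :
    levi (quadForm g) (z, ξ) (ξ, η) + curvForm g z ξ =
      quadForm g (z, η - geodesicAccel g z ξ) := by
  -- `e` is the row vector `b G⁻¹`, so that the geodesic acceleration is `-e`.
  set b := derivCovector g z ξ with hb
  set e := Matrix.vecMul b (g z)⁻¹ with he
  have hbe : Matrix.vecMul e (g z) = b := by
    rw [he, Matrix.vecMul_vecMul, Matrix.nonsing_inv_mul _ (hg.det_isUnit hz), Matrix.vecMul_one]
  have hb1 (j) : ∑ i, e i * g z i j = b j := congrFun hbe j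
  have h1 (x : Fin n → ℂ) : ∑ i, ∑ j, g z i j * e i * conj (x j) = ∑ j, b j * conj (x j) := by
    rw [Finset.sum_comm]
    refine Finset.sum_congr rfl fun j _ => ?_
    rw [← hb1, Finset.sum_mul]
    exact Finset.sum_congr rfl fun i _ => by ring
  have h2 (x : Fin n → ℂ) : ∑ i, ∑ j, g z i j * x i * conj (e j) = ∑ i, x i * conj (b i) := by
    refine Finset.sum_congr rfl fun i _ => ?_
    rw [← hb1, map_sum, Finset.mul_sum]
    refine Finset.sum_congr rfl fun j _ => ?_
    rw [map_mul, hg.conj_symm z hz]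
    ring
  rw [hg.levi_quadForm hz, hg.curvForm_eq hz, ← hb, ← he]
  have h3 : quadForm g (z, η - geodesicAccel g z ξ) =
      ∑ i, ∑ j, g z i j * η i * conj (η j) + ∑ i, ∑ j, g z i j * η i * conj (e j)
        + ∑ i, ∑ j, g z i j * e i * conj (η j) + ∑ i, ∑ j, g z i j * e i * conj (e j) := by
    simp only [quadForm, ← Finset.sum_add_distrib, geodesicAccel, ← hb, ← he]
    refine Finset.sum_congr rfl fun i _ => Finset.sum_congr rfl fun j _ => ?_
    simp only [sub_neg_eq_add, PiLp.add_apply, map_add]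
    ring
  rw [h3, h2, h1, h2]
  ring

theorem quadForm_im (hg : IsHermMatrixOn g U) (hz : z ∈ U) (v : Cn n) :
    (quadForm g (z, v)).im = 0 := by
  rw [← Complex.conj_eq_iff_im, quadForm]
  simp only [map_sum, map_mul, Complex.conj_conj, hg.conj_symm z hz]
  rw [Finset.sum_comm]
  exact Finset.sum_congr rfl fun i _ => Finset.sum_congr rfl fun j _ => by ring

theorem holSectCurv_pos_iff (hg : IsHermMatrixOn g U) (hz : z ∈ U) {ξ : Cn n} (hξ : ξ ≠ 0) :
    0 < holSectCurv g z ξ ↔ 0 < (curvForm g z ξ).re := by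
  have h1 : (∑ i, ∑ j, ∑ k, ∑ l, g z i j * g z k l * ξ i * conj (ξ j) * ξ k * conj (ξ l)) =
      (((quadForm g (z, ξ)).re ^ 2 : ℝ) : ℂ) := by
    have h2 : quadForm g (z, ξ) = ((quadForm g (z, ξ)).re : ℂ) := by
      apply Complex.ext <;> simp [hg.quadForm_im hz]
    push_cast
    rw [← h2, sq]
    simp only [quadForm, Finset.sum_mul, Finset.mul_sum]
    refine Finset.sum_congr rfl fun i _ => Finset.sum_congr rfl fun j _ =>
      Finset.sum_congr rfl fun k _ => Finset.sum_congr rfl fun l _ => by ring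
  have h3 := hg.pos z hz ξ hξ
  rw [holSectCurv, h1, Complex.div_ofReal_re, div_pos_iff_of_pos_right (by positivity)]
  change 0 < (2 * curvForm g z ξ).re ↔ _
  simp

/-- The holomorphic sectional curvature is positive in the direction `ξ` if and only if the Levi
form of `(z, v) ↦ g(v, v)` at `(z, ξ)` is negative on some lift of `ξ`. -/
theorem holSectCurv_pos_iff_exists (hg : IsHermMatrixOn g U) (hz : z ∈ U) {ξ : Cn n} (hξ : ξ ≠ 0) :
    0 < holSectCurv g z ξ ↔ ∃ η, (levi (quadForm g) (z, ξ) (ξ, η)).re < 0 := by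
  rw [hg.holSectCurv_pos_iff hz hξ]
  constructor
  · intro h
    refine ⟨geodesicAccel g z ξ, ?_⟩
    have := congrArg Complex.re (hg.levi_add_curvForm hz ξ (geodesicAccel g z ξ))
    simp [quadForm] at this
    linarith
  · rintro ⟨η, h⟩
    have := congrArg Complex.re (hg.levi_add_curvForm hz ξ η)
    rw [Complex.add_re] at this
    by_cases h0 : η - geodesicAccel g z ξ = 0
    · simp [h0, quadForm] at this
      linarith
    · have := hg.pos z hz _ h0
      linarith

theorem levi_geodesicAccel_neg (hg : IsHermMatrixOn g U) (hz : z ∈ U) {ξ : Cn n} (hξ : ξ ≠ 0)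
    (h : 0 < holSectCurv g z ξ) :
    (levi (quadForm g) (z, ξ) (ξ, geodesicAccel g z ξ)).re < 0 := by
  rw [hg.holSectCurv_pos_iff hz hξ] at h
  have := congrArg Complex.re (hg.levi_add_curvForm hz ξ (geodesicAccel g z ξ))
  simp [quadForm] at this
  linarith

theorem continuousAt_geodesicAccel (hg : IsHermMatrixOn g U) (hz : z ∈ U) (ξ : Cn n) :
    ContinuousAt (fun p : Cn n × Cn n => geodesicAccel g p.1 p.2) (z, ξ) := by
  have hd (i j) : ContinuousAt (fun p : Cn n × Cn n => fderiv ℝ (fun w => g w i j) p.1) (z, ξ) :=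
    ContinuousAt.comp (f := Prod.fst)
      ((hg.contDiffAt_two hz i j).fderiv_right (m := 1) (by norm_num)).continuousAt continuousAt_fst
  have hs : ContinuousAt (fun p : Cn n × Cn n => p.2) (z, ξ) := continuousAt_snd
  have hs' (i) : ContinuousAt (fun p : Cn n × Cn n => p.2 i) (z, ξ) :=
    (EuclideanSpace.proj (𝕜 := ℂ) i).continuous.continuousAt.comp hs
  have hsI : ContinuousAt (fun p : Cn n × Cn n => Complex.I • p.2) (z, ξ) := hs.fun_const_smul _
  have hw (i j) : ContinuousAt (fun p : Cn n × Cn n => wirt p.2 (fun w => g w i j) p.1) (z, ξ) :=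
    (((hd i j).clm_apply hs).sub (continuousAt_const.mul ((hd i j).clm_apply hsI))).div_const 2
  have hb (q) : ContinuousAt (fun p : Cn n × Cn n => derivCovector g p.1 p.2 q) (z, ξ) := by
    exact tendsto_finsetSum _ fun i _ => (hw i q).mul (hs' i)
  have hG : ContinuousAt (fun p : Cn n × Cn n => g p.1) (z, ξ) := by
    refine continuousAt_pi.2 fun i => continuousAt_pi.2 fun j => ?_
    exact ContinuousAt.comp (g := fun w => g w i j) (f := Prod.fst) (x := (z, ξ))
      (hg.contDiffAt hz i j).continuousAt continuousAt_fst
  have hdet : Continuous fun A : Matrix (Fin n) (Fin n) ℂ => A.det :=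
    Continuous.matrix_det continuous_id
  have hadj (i j) : Continuous fun A : Matrix (Fin n) (Fin n) ℂ => A.adjugate i j :=
    (Continuous.matrix_adjugate continuous_id).matrix_elem i j
  have hI (i j) : ContinuousAt (fun p : Cn n × Cn n => (g p.1)⁻¹ i j) (z, ξ) := by
    simp only [Matrix.inv_def, Ring.inverse_eq_inv', Matrix.smul_apply, smul_eq_mul]
    exact ((hdet.continuousAt.comp hG).inv₀ (hg.det_isUnit hz).ne_zero).mul
      ((hadj i j).continuousAt.comp hG)
  unfold geodesicAccel
  refine ((PiLp.continuous_toLp 2 _).continuousAt.comp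
    (f := fun p : Cn n × Cn n => Matrix.vecMul (derivCovector g p.1 p.2) (g p.1)⁻¹) ?_).neg
  refine continuousAt_pi.2 fun j => ?_
  simp only [Matrix.vecMul, dotProduct]
  exact tendsto_finsetSum _ fun i _ => (hb i).mul (hI i j)

end IsHermMatrixOn

theorem holSectCurv_smul (g : Cn n → Matrix (Fin n) (Fin n) ℂ) (z ξ : Cn n) {c : ℂ} (hc : c ≠ 0) :
    holSectCurv g z (c • ξ) = holSectCurv g z ξ := by
  have h (f : Fin n → Fin n → Fin n → Fin n → ℂ) :
      ∑ i, ∑ j, ∑ k, ∑ l, f i j k l * (c • ξ) i * conj ((c • ξ) j) * (c • ξ) k * conj ((c • ξ) l) =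
        (c * conj c) ^ 2 * ∑ i, ∑ j, ∑ k, ∑ l, f i j k l * ξ i * conj (ξ j) * ξ k * conj (ξ l) := by
    simp only [Finset.mul_sum, PiLp.smul_apply, smul_eq_mul, map_mul]
    refine Finset.sum_congr rfl fun i _ => Finset.sum_congr rfl fun j _ =>
      Finset.sum_congr rfl fun k _ => Finset.sum_congr rfl fun l _ => by ring
  have hc' : (c * conj c) ^ 2 ≠ 0 := by
    simpa using hc
  rw [holSectCurv, holSectCurv, h, h fun i j k l => g z i j * g z k l, mul_left_comm,
    mul_div_mul_left _ _ hc']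

end Matrix

/-! ### Forms in holomorphic charts -/

section LocalForms

variable {n k : ℕ} {X Y : Type*} [TopologicalSpace X] [ChartedSpace (Cn n) X]
  [TopologicalSpace Y] [ChartedSpace (Cn k) Y]

/-- The sesquilinear form `∑ A_{i j̄} v_i w̄_j` of a matrix. -/
def sesqForm (A : Matrix (Fin n) (Fin n) ℂ) (v w : Cn n) : ℂ :=
  ∑ i, ∑ j, A i j * v i * conj (w j)

theorem quadForm_eq_sesqForm (g : Cn n → Matrix (Fin n) (Fin n) ℂ) (z v : Cn n) :
    quadForm g (z, v) = sesqForm (g z) v v := rfl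

theorem sesqForm_stdVec (A : Matrix (Fin n) (Fin n) ℂ) (i j : Fin n) :
    sesqForm A (stdVec i) (stdVec j) = A i j := by
  simp [sesqForm, stdVec]

theorem eq_sesqForm (B : Cn n →ₗ[ℂ] Cn n →ₗ⋆[ℂ] ℂ) (v w : Cn n) :
    B v w = sesqForm (Matrix.of fun i j => B (stdVec i) (stdVec j)) v w := by
  conv_lhs => rw [← sum_smul_stdVec v, ← sum_smul_stdVec w]
  simp only [map_sum, map_smul, LinearMap.sum_apply, LinearMap.smul_apply, map_smulₛₗ, smul_eq_mul,
    sesqForm, Matrix.of_apply]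
  rw [Finset.sum_comm]
  refine Finset.sum_congr rfl fun i _ => ?_
  rw [Finset.mul_sum]
  exact Finset.sum_congr rfl fun j _ => by ring

/-- The matrix of coefficients represents the form. -/
theorem apply_mfderiv_symm (g : SesqField (n := n) X) (φ : OpenPartialHomeomorph X (Cn n))
    (z v w : Cn n) :
    g (φ.symm z) (mfderiv 𝓘(ℂ, Cn n) 𝓘(ℂ, Cn n) φ.symm z v)
      (mfderiv 𝓘(ℂ, Cn n) 𝓘(ℂ, Cn n) φ.symm z w) = sesqForm (coeff g φ z) v w := by
  let D : Cn n →ₗ[ℂ] TangentSpace 𝓘(ℂ, Cn n) (φ.symm z) :=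
    (mfderiv 𝓘(ℂ, Cn n) 𝓘(ℂ, Cn n) φ.symm z).toLinearMap
  exact eq_sesqForm (((g (φ.symm z)).compl₂ D).comp D) v w

/-- The map `f` read in the charts `φ` and `χ`. -/
def localRep (f : X → Y) (φ : OpenPartialHomeomorph X (Cn n)) (χ : OpenPartialHomeomorph Y (Cn k)) :
    Cn n → Cn k :=
  fun z => χ (f (φ.symm z))

/-- The tangent map of a map between coordinate spaces. -/
def tangentLift (ψ : Cn n → Cn k) (p : Cn n × Cn n) : Cn k × Cn k :=
  (ψ p.1, fderiv ℂ ψ p.1 p.2)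

theorem contDiffAt_tangentLift {ψ : Cn n → Cn k} {p : Cn n × Cn n} (h : ContDiffAt ℂ ω ψ p.1) :
    ContDiffAt ℂ 2 (tangentLift ψ) p := by
  have h1 : ContDiffAt ℂ ω (fun q : Cn n × Cn n => ψ q.1) p :=
    ContDiffAt.comp (f := Prod.fst) p h contDiffAt_fst
  have h2 : ContDiffAt ℂ ω (fun q : Cn n × Cn n => fderiv ℂ ψ q.1) p :=
    ContDiffAt.comp (g := fderiv ℂ ψ) (f := Prod.fst) p (h.fderiv_right (by simp)) contDiffAt_fst
  exact (h1.prodMk (h2.clm_apply contDiffAt_snd)).of_le le_top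

theorem fderiv_tangentLift_fst {ψ : Cn n → Cn k} {p : Cn n × Cn n} (h : ContDiffAt ℂ ω ψ p.1)
    (w : Cn n × Cn n) : (fderiv ℂ (tangentLift ψ) p w).1 = fderiv ℂ ψ p.1 w.1 := by
  have h1 : DifferentiableAt ℂ (tangentLift ψ) p :=
    (contDiffAt_tangentLift h).differentiableAt (by simp)
  have h2 : HasFDerivAt (fun q => (tangentLift ψ q).1)
      ((ContinuousLinearMap.fst ℂ _ _).comp (fderiv ℂ (tangentLift ψ) p)) p :=
    hasFDerivAt_fst.comp p h1.hasFDerivAt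
  have h3 : HasFDerivAt (fun q : Cn n × Cn n => ψ q.1)
      ((fderiv ℂ ψ p.1).comp (ContinuousLinearMap.fst ℂ _ _)) p :=
    HasFDerivAt.comp (f := Prod.fst) p (h.differentiableAt (by simp)).hasFDerivAt hasFDerivAt_fst
  exact congrArg (fun L => L w) (h2.unique h3)

variable {f : X → Y} {φ : OpenPartialHomeomorph X (Cn n)} {χ : OpenPartialHomeomorph Y (Cn k)}
  {z : Cn n}

theorem contDiffAt_localRep (hf : ContMDiff 𝓘(ℂ, Cn n) 𝓘(ℂ, Cn k) ω f)
    (hφ : φ ∈ holoCharts (n := n) X) (hχ : χ ∈ holoCharts (n := k) Y) (hz : z ∈ φ.target)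
    (hfz : f (φ.symm z) ∈ χ.source) : ContDiffAt ℂ ω (localRep f φ χ) z := by
  have h1 : ContMDiffAt 𝓘(ℂ, Cn n) 𝓘(ℂ, Cn n) ω φ.symm z :=
    (contMDiffOn_symm_of_mem_maximalAtlas hφ).contMDiffAt (φ.open_target.mem_nhds hz)
  have h2 : ContMDiffAt 𝓘(ℂ, Cn k) 𝓘(ℂ, Cn k) ω χ (f (φ.symm z)) :=
    (contMDiffOn_of_mem_maximalAtlas hχ).contMDiffAt (χ.open_source.mem_nhds hfz)
  exact (h2.comp z ((hf _).comp z h1)).contDiffAt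

omit [ChartedSpace (Cn n) X] [ChartedSpace (Cn k) Y] in
theorem eventually_mem_source (hf : Continuous f) (hz : z ∈ φ.target)
    (hfz : f (φ.symm z) ∈ χ.source) :
    ∀ᶠ w in nhds z, w ∈ φ.target ∧ f (φ.symm w) ∈ χ.source := by
  have h1 : ContinuousAt (fun w => f (φ.symm w)) z :=
    hf.continuousAt.comp (φ.continuousAt_symm hz)
  exact (φ.open_target.eventually_mem hz).and (h1.eventually (χ.open_source.eventually_mem hfz))

/-- Tangent spaces at equal points are identified with `ℂᵏ`, which allows rewriting of the base
point of a form. -/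
theorem SesqField.congr_point (h : SesqField (n := k) Y) {x y : Y} (hxy : x = y)
    (u v u' v' : Cn k) (hu : u = u') (hv : v = v') :
    (h x : Cn k →ₗ[ℂ] Cn k →ₗ⋆[ℂ] ℂ) u v = (h y : Cn k →ₗ[ℂ] Cn k →ₗ⋆[ℂ] ℂ) u' v' := by
  subst hxy hu hv; rfl

theorem mfderiv_symm_fderiv_localRep (hf : ContMDiff 𝓘(ℂ, Cn n) 𝓘(ℂ, Cn k) ω f)
    (hφ : φ ∈ holoCharts (n := n) X) (hχ : χ ∈ holoCharts (n := k) Y) (hz : z ∈ φ.target)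
    (hfz : f (φ.symm z) ∈ χ.source) (v : Cn n) :
    (mfderiv 𝓘(ℂ, Cn k) 𝓘(ℂ, Cn k) χ.symm (localRep f φ χ z)
      (fderiv ℂ (localRep f φ χ) z v) : Cn k) =
      mfderiv 𝓘(ℂ, Cn n) 𝓘(ℂ, Cn k) f (φ.symm z) (mfderiv 𝓘(ℂ, Cn n) 𝓘(ℂ, Cn n) φ.symm z v) := by
  have hψm : MDifferentiableAt 𝓘(ℂ, Cn n) 𝓘(ℂ, Cn k) (localRep f φ χ) z :=
    ((contDiffAt_localRep hf hφ hχ hz hfz).differentiableAt (by simp)).mdifferentiableAt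
  have hφs : MDifferentiableAt 𝓘(ℂ, Cn n) 𝓘(ℂ, Cn n) φ.symm z :=
    mdifferentiableAt_symm_of_mem_maximalAtlas
      (IsManifold.maximalAtlas_subset_of_le le_top hφ) hz
  have hχs : MDifferentiableAt 𝓘(ℂ, Cn k) 𝓘(ℂ, Cn k) χ.symm (localRep f φ χ z) :=
    mdifferentiableAt_symm_of_mem_maximalAtlas
      (IsManifold.maximalAtlas_subset_of_le le_top hχ) (χ.map_source hfz)
  have hfm : MDifferentiableAt 𝓘(ℂ, Cn n) 𝓘(ℂ, Cn k) f (φ.symm z) :=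
    (hf _).mdifferentiableAt (by simp)
  have he : f ∘ φ.symm =ᶠ[nhds z] χ.symm ∘ localRep f φ χ := by
    filter_upwards [eventually_mem_source hf.continuous hz hfz] with y hy
    exact (χ.left_inv hy.2).symm
  have h1 := he.mfderiv_eq (I := 𝓘(ℂ, Cn n)) (I' := 𝓘(ℂ, Cn k))
  rw [mfderiv_comp z hfm hφs, mfderiv_comp z hχs hψm, mfderiv_eq_fderiv] at h1
  exact (congrArg (fun L : Cn n →L[ℂ] Cn k => L v) h1).symm

/-- Coordinate expression of the pull-back of a form under a holomorphic map. -/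
theorem apply_mfderiv_mfderiv (hf : ContMDiff 𝓘(ℂ, Cn n) 𝓘(ℂ, Cn k) ω f)
    (hφ : φ ∈ holoCharts (n := n) X) (hχ : χ ∈ holoCharts (n := k) Y) (hz : z ∈ φ.target)
    (hfz : f (φ.symm z) ∈ χ.source) (h : SesqField (n := k) Y) (v w : Cn n) :
    h (f (φ.symm z))
      (mfderiv 𝓘(ℂ, Cn n) 𝓘(ℂ, Cn k) f (φ.symm z) (mfderiv 𝓘(ℂ, Cn n) 𝓘(ℂ, Cn n) φ.symm z v))
      (mfderiv 𝓘(ℂ, Cn n) 𝓘(ℂ, Cn k) f (φ.symm z) (mfderiv 𝓘(ℂ, Cn n) 𝓘(ℂ, Cn n) φ.symm z w)) =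
    sesqForm (coeff h χ (localRep f φ χ z)) (fderiv ℂ (localRep f φ χ) z v)
      (fderiv ℂ (localRep f φ χ) z w) := by
  rw [← apply_mfderiv_symm]
  exact SesqField.congr_point h (χ.left_inv hfz).symm _ _ _ _
    (mfderiv_symm_fderiv_localRep hf hφ hχ hz hfz v).symm
    (mfderiv_symm_fderiv_localRep hf hφ hχ hz hfz w).symm

theorem mfderiv_mfderiv_symm (hφ : φ ∈ holoCharts (n := n) X) (hz : z ∈ φ.target) (v : Cn n) :
    (mfderiv 𝓘(ℂ, Cn n) 𝓘(ℂ, Cn n) φ (φ.symm z)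
      (mfderiv 𝓘(ℂ, Cn n) 𝓘(ℂ, Cn n) φ.symm z v) : Cn n) = v := by
  have hφ1 := IsManifold.maximalAtlas_subset_of_le (n := ω) (m := 1) le_top hφ
  have h1 : MDifferentiableAt 𝓘(ℂ, Cn n) 𝓘(ℂ, Cn n) φ.symm z :=
    mdifferentiableAt_symm_of_mem_maximalAtlas hφ1 hz
  have h2 : MDifferentiableAt 𝓘(ℂ, Cn n) 𝓘(ℂ, Cn n) φ (φ.symm z) :=
    mdifferentiableAt_of_mem_maximalAtlas hφ1 (φ.map_target hz)
  have h3 : φ ∘ φ.symm =ᶠ[nhds z] id := by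
    filter_upwards [φ.open_target.mem_nhds hz] with w hw
    exact φ.right_inv hw
  have h4 := h3.mfderiv_eq (I := 𝓘(ℂ, Cn n)) (I' := 𝓘(ℂ, Cn n))
  rw [mfderiv_comp z h2 h1, mfderiv_id] at h4
  exact congrArg (fun L : Cn n →L[ℂ] Cn n => L v) h4

/-- The coordinate vectors of a holomorphic chart are linearly independent. -/
theorem mfderiv_symm_injective (hφ : φ ∈ holoCharts (n := n) X) (hz : z ∈ φ.target) :
    Function.Injective (mfderiv 𝓘(ℂ, Cn n) 𝓘(ℂ, Cn n) φ.symm z) :=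
  Function.LeftInverse.injective (g := mfderiv 𝓘(ℂ, Cn n) 𝓘(ℂ, Cn n) φ (φ.symm z))
    (mfderiv_mfderiv_symm hφ hz)

theorem mfderiv_symm_surjective (hφ : φ ∈ holoCharts (n := n) X) (hz : z ∈ φ.target) :
    Function.Surjective (mfderiv 𝓘(ℂ, Cn n) 𝓘(ℂ, Cn n) φ.symm z) := by
  let D : Cn n →ₗ[ℂ] Cn n := (mfderiv 𝓘(ℂ, Cn n) 𝓘(ℂ, Cn n) φ.symm z).toLinearMap
  exact (LinearMap.injective_iff_surjective (f := D)).1 (mfderiv_symm_injective hφ hz)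

end LocalForms

section ChangeOfChart

variable {n : ℕ} {X : Type*} [TopologicalSpace X] [ChartedSpace (Cn n) X]
  {φ φ' : OpenPartialHomeomorph X (Cn n)} {z : Cn n}

theorem sesqForm_coeff_eq (hφ : φ ∈ holoCharts (n := n) X) (hφ' : φ' ∈ holoCharts (n := n) X)
    (hz : z ∈ φ.target) (hz' : φ.symm z ∈ φ'.source) (g : SesqField (n := n) X) (v w : Cn n) :
    sesqForm (coeff g φ z) v w =
      sesqForm (coeff g φ' (localRep id φ φ' z)) (fderiv ℂ (localRep id φ φ') z v)
        (fderiv ℂ (localRep id φ φ') z w) := by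
  rw [← apply_mfderiv_symm, ← apply_mfderiv_mfderiv contMDiff_id hφ hφ' hz hz', mfderiv_id]
  rfl

theorem quadForm_coeff_eventuallyEq (hφ : φ ∈ holoCharts (n := n) X)
    (hφ' : φ' ∈ holoCharts (n := n) X) (hz : z ∈ φ.target) (hz' : φ.symm z ∈ φ'.source)
    (g : SesqField (n := n) X) (v : Cn n) :
    quadForm (coeff g φ) =ᶠ[nhds (z, v)]
      quadForm (coeff g φ') ∘ tangentLift (localRep id φ φ') := by
  filter_upwards [continuousAt_fst.eventually (eventually_mem_source (f := (id : X → X))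
    continuous_id hz hz')] with p hp
  exact sesqForm_coeff_eq hφ hφ' hp.1 hp.2 g p.2 p.2

theorem fderiv_localRep_localRep (hφ : φ ∈ holoCharts (n := n) X)
    (hφ' : φ' ∈ holoCharts (n := n) X) (hz : z ∈ φ.target) (hz' : φ.symm z ∈ φ'.source)
    (v : Cn n) :
    fderiv ℂ (localRep id φ' φ) (localRep id φ φ' z) (fderiv ℂ (localRep id φ φ') z v) = v := by
  have h1 := contDiffAt_localRep (f := (id : X → X)) contMDiff_id hφ hφ' hz hz'
  have hx : φ'.symm (localRep id φ φ' z) = φ.symm z := φ'.left_inv hz'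
  have h2 := contDiffAt_localRep (f := (id : X → X)) contMDiff_id hφ' hφ
    (z := localRep id φ φ' z) (φ'.map_source hz') (by rw [hx]; exact φ.map_target hz)
  have h3 : localRep id φ' φ ∘ localRep id φ φ' =ᶠ[nhds z] id := by
    filter_upwards [eventually_mem_source (f := (id : X → X)) continuous_id hz hz'] with w hw
    change φ (φ'.symm (φ' (φ.symm w))) = w
    rw [φ'.left_inv (show φ.symm w ∈ φ'.source from hw.2), φ.right_inv hw.1]
  have h4 := fderiv_comp z (h2.differentiableAt (by simp)) (h1.differentiableAt (by simp))
  rw [h3.fderiv_eq, fderiv_id] at h4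
  exact (congrArg (fun L => L v) h4).symm

namespace IsHermitianMetric

variable {g : SesqField (n := n) X}

theorem isHermMatrixOn (hg : IsHermitianMetric g) (hφ : φ ∈ holoCharts (n := n) X) :
    IsHermMatrixOn (coeff g φ) φ.target where
  isOpen := φ.open_target
  smooth := hg.smooth φ hφ
  conj_symm z _ i j := hg.conj_symm _ _ _
  pos z hz v hv := by
    rw [quadForm_eq_sesqForm, ← apply_mfderiv_symm]
    refine hg.pos _ _ fun h0 => hv ?_
    exact mfderiv_symm_injective hφ hz (h0.trans (map_zero _).symm)

/-- Positivity of the holomorphic sectional curvature in all directions at a point does not depend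
on the chart: the tangent map of the coordinate change maps lifts of `ξ` to lifts of its image, and
Levi forms are invariant. -/
theorem holSectCurv_pos_of_chart (hg : IsHermitianMetric g) (hφ : φ ∈ holoCharts (n := n) X)
    (hφ' : φ' ∈ holoCharts (n := n) X) (hz : z ∈ φ.target) (hz' : φ.symm z ∈ φ'.source)
    (hpos : ∀ ξ : Cn n, ξ ≠ 0 → 0 < holSectCurv (coeff g φ) z ξ) {ξ' : Cn n} (hξ' : ξ' ≠ 0) :
    0 < holSectCurv (coeff g φ') (localRep id φ φ' z) ξ' := by
  have hx : φ'.symm (localRep id φ φ' z) = φ.symm z := φ'.left_inv hz'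
  have hxz : localRep id φ' φ (localRep id φ φ' z) = z := by
    change φ (φ'.symm _) = z
    rw [hx, φ.right_inv hz]
  have hzt : localRep id φ φ' z ∈ φ'.target := φ'.map_source hz'
  set ξ := fderiv ℂ (localRep id φ' φ) (localRep id φ φ' z) ξ' with hξ
  have hξξ' : fderiv ℂ (localRep id φ φ') z ξ = ξ' := by
    have := fderiv_localRep_localRep hφ' hφ hzt (by rw [hx]; exact φ.map_target hz) ξ'
    rwa [hxz] at this
  have hξ0 : ξ ≠ 0 := by
    rintro h0
    rw [h0, map_zero] at hξξ'
    exact hξ' hξξ'.symm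
  obtain ⟨η, hη⟩ := ((hg.isHermMatrixOn hφ).holSectCurv_pos_iff_exists hz hξ0).1 (hpos ξ hξ0)
  have hψ := contDiffAt_localRep (f := (id : X → X)) contMDiff_id hφ hφ' hz hz'
  have hT : tangentLift (localRep id φ φ') (z, ξ) = (localRep id φ φ' z, ξ') := by
    simp only [tangentLift, hξξ']
  have hg' := hg.isHermMatrixOn hφ'
  rw [levi_congr (quadForm_coeff_eventuallyEq hφ hφ' hz hz' g ξ),
    levi_comp (by rw [hT]; exact hg'.contDiffAt_quadForm hzt ξ')
      (contDiffAt_tangentLift (p := (z, ξ)) hψ), hT] at hη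
  refine (hg'.holSectCurv_pos_iff_exists hzt hξ').2
    ⟨(fderiv ℂ (tangentLift (localRep id φ φ')) (z, ξ) (ξ, η)).2, ?_⟩
  convert hη using 3
  refine Prod.ext ?_ rfl
  rw [fderiv_tangentLift_fst (p := (z, ξ)) hψ, hξξ']

end IsHermitianMetric

end ChangeOfChart

/-- If the coefficients of a form are smooth, so are those of its pull-back under a holomorphic
map of coordinate spaces. -/
theorem contDiffAt_sesqForm_comp {n k : ℕ} {A : Cn k → Matrix (Fin k) (Fin k) ℂ} {ψ : Cn n → Cn k}
    {z : Cn n} (hψ : ContDiffAt ℂ ω ψ z) (hA : ∀ a b, ContDiffAt ℝ ∞ (fun y => A y a b) (ψ z))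
    (v w : Cn n) :
    ContDiffAt ℝ ∞ (fun y => sesqForm (A (ψ y)) (fderiv ℂ ψ y v) (fderiv ℂ ψ y w)) z := by
  have h1 : ContDiffAt ℝ ∞ ψ z := (hψ.restrict_scalars ℝ).of_le le_top
  have h2 (v : Cn n) (a : Fin k) : ContDiffAt ℝ ∞ (fun y => fderiv ℂ ψ y v a) z := by
    have : ContDiffAt ℂ ω (fun y => fderiv ℂ ψ y v) z :=
      (hψ.fderiv_right (m := ω) (by simp)).clm_apply contDiffAt_const
    have h3 : ContDiffAt ℂ ω (fun y => fderiv ℂ ψ y v a) z :=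
      (EuclideanSpace.proj (𝕜 := ℂ) a).contDiff.contDiffAt.comp z this
    exact (h3.restrict_scalars ℝ).of_le le_top
  refine ContDiffAt.sum fun a _ => ContDiffAt.sum fun b _ => ?_
  exact (((hA a b).comp z h1).mul (h2 v a)).mul
    (Complex.conjCLE.contDiff.contDiffAt.comp z (h2 w b))

/-! ### Existence of adapted coordinates -/

section AdaptedCharts

variable {s m : ℕ}

/-- The last coordinates, as a continuous linear map. -/
def lastCoordsL (s m : ℕ) : Cn (s + m) →L[ℂ] Cn m :=
  LinearMap.toContinuousLinearMap
    { toFun := lastCoords s m, map_add' := fun _ _ => rfl, map_smul' := fun _ _ => rfl }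

@[simp]
theorem lastCoordsL_apply (z : Cn (s + m)) : lastCoordsL s m z = lastCoords s m z := rfl

/-- `join`, as a continuous linear map. -/
def joinL (s m : ℕ) : Cn s × Cn m →L[ℂ] Cn (s + m) :=
  LinearMap.toContinuousLinearMap
    { toFun := fun p => join p.1 p.2
      map_add' := fun p q => by
        ext i
        refine Fin.addCases (fun i => ?_) (fun i => ?_) i <;> simp [join]
      map_smul' := fun c p => by
        ext i
        refine Fin.addCases (fun i => ?_) (fun i => ?_) i <;> simp [join] }

@[simp]
theorem joinL_apply (p : Cn s × Cn m) : joinL s m p = join p.1 p.2 := rfl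

@[simp]
theorem join_castAdd (w : Cn s) (c : Cn m) (i : Fin s) : join w c (Fin.castAdd m i) = w i := by
  simp [join]

@[simp]
theorem join_natAdd (w : Cn s) (c : Cn m) (i : Fin m) : join w c (Fin.natAdd s i) = c i := by
  simp [join]

@[simp]
theorem lastCoords_join (w : Cn s) (c : Cn m) : lastCoords s m (join w c) = c := by
  ext i
  simp [lastCoords]

theorem join_eq_zero_iff {w : Cn s} {c : Cn m} : join w c = 0 ↔ w = 0 ∧ c = 0 := by
  constructor
  · intro h
    refine ⟨?_, ?_⟩
    · ext i
      rw [← join_castAdd w c i, h]; rfl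
    · rw [← lastCoords_join w c, h]; rfl
  · rintro ⟨rfl, rfl⟩
    exact (joinL s m).map_zero

/-- The first coordinates `(z_1, …, z_s)`. -/
def firstCoords (s m : ℕ) (z : Cn (s + m)) : Cn s := WithLp.toLp 2 fun i => z (Fin.castAdd m i)

theorem join_firstCoords_lastCoords (z : Cn (s + m)) :
    join (firstCoords s m z) (lastCoords s m z) = z := by
  ext i
  refine Fin.addCases (fun i => ?_) (fun i => ?_) i
  · rw [join_castAdd]; rfl
  · rw [join_natAdd]; rfl

/-- A chart composed with a biholomorphic map of open subsets of `ℂⁿ` is a holomorphic chart. -/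
theorem trans_mem_holoCharts {n : ℕ} {X : Type*} [TopologicalSpace X] [ChartedSpace (Cn n) X]
    [IsManifold 𝓘(ℂ, Cn n) ω X] {φ : OpenPartialHomeomorph X (Cn n)}
    (hφ : φ ∈ holoCharts (n := n) X) {e : OpenPartialHomeomorph (Cn n) (Cn n)}
    (he : e ∈ contDiffGroupoid ω 𝓘(ℂ, Cn n)) : φ.trans e ∈ holoCharts (n := n) X := by
  rw [IsManifold.mem_maximalAtlas_iff, mem_maximalAtlas_iff]
  intro e' he'
  have he'' := IsManifold.subset_maximalAtlas (I := 𝓘(ℂ, Cn n)) (n := ω) he'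
  constructor
  · rw [OpenPartialHomeomorph.trans_symm_eq_symm_trans_symm, OpenPartialHomeomorph.trans_assoc]
    exact StructureGroupoid.trans _ (StructureGroupoid.symm _ he)
      (IsManifold.compatible_of_mem_maximalAtlas hφ he'')
  · rw [← OpenPartialHomeomorph.trans_assoc]
    exact StructureGroupoid.trans _ (IsManifold.compatible_of_mem_maximalAtlas he'' hφ) he

theorem mem_contDiffGroupoid_of_contDiffOn {n : ℕ} {e : OpenPartialHomeomorph (Cn n) (Cn n)}
    (h : ContDiffOn ℂ ω e e.source) (h' : ContDiffOn ℂ ω e.symm e.target) :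
    e ∈ contDiffGroupoid ω 𝓘(ℂ, Cn n) := by
  rw [contDiffGroupoid, mem_groupoid_of_pregroupoid]
  simpa [contDiffPregroupoid] using And.intro h h'

/-- The holomorphic inverse function theorem, on a neighbourhood on which the inverse is
holomorphic. -/
theorem exists_mem_contDiffGroupoid {n : ℕ} {Θ : Cn n → Cn n} {z : Cn n}
    (hΘ : ContDiffAt ℂ ω Θ z) (hinj : Function.Injective (fderiv ℂ Θ z)) {S : Set (Cn n)}
    (hS : S ∈ nhds z) :
    ∃ e ∈ contDiffGroupoid ω 𝓘(ℂ, Cn n), z ∈ e.source ∧ e.source ⊆ S ∧ ∀ w, e w = Θ w := by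
  let A : Cn n ≃L[ℂ] Cn n :=
    (LinearEquiv.ofInjectiveEndo (fderiv ℂ Θ z).toLinearMap hinj).toContinuousLinearEquiv
  have hA : (A : Cn n →L[ℂ] Cn n) = fderiv ℂ Θ z := by ext v; rfl
  have hΘ' : HasFDerivAt Θ (A : Cn n →L[ℂ] Cn n) z := by
    rw [hA]; exact (hΘ.differentiableAt (by simp)).hasFDerivAt
  let e₀ := hΘ.toOpenPartialHomeomorph Θ hΘ' (by simp)
  have hnh : {w | ContDiffAt ℂ ω Θ w ∧ fderiv ℂ Θ w ∈
      Set.range (ContinuousLinearEquiv.toContinuousLinearMap : (Cn n ≃L[ℂ] Cn n) → _)} ∩ S ∈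
        nhds z := by
    refine Filter.inter_mem (Filter.Eventually.and (hΘ.eventually (by simp)) ?_) hS
    have hc : ContinuousAt (fderiv ℂ Θ) z :=
      (hΘ.fderiv_right (m := ω) (by simp)).continuousAt
    exact hc.eventually (by rw [← hA]; exact ContinuousLinearEquiv.nhds A)
  -- The derivative is invertible on all of `V`, so the inverse is holomorphic on all of `e.target`.
  obtain ⟨V, hVS, hVo, hzV⟩ := mem_nhds_iff.1 hnh
  let e := e₀.restrOpen V hVo
  have hsrc : e.source = e₀.source ∩ V := e₀.restrOpen_source V hVo
  have heV : e.source ⊆ V := hsrc ▸ Set.inter_subset_right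
  have hcoe : ∀ w, e w = Θ w := fun w => rfl
  refine ⟨e, mem_contDiffGroupoid_of_contDiffOn ?_ ?_, ?_, fun w hw => (hVS (heV hw)).2, hcoe⟩
  · intro w hw
    exact (hVS (heV hw)).1.1.contDiffWithinAt
  · intro y hy
    have hw := heV (e.map_target hy)
    obtain ⟨B, hB⟩ := (hVS hw).1.2
    refine (e.contDiffAt_symm (f₀' := B) hy ?_ (hVS hw).1.1).contDiffWithinAt
    rw [hB]
    exact ((hVS hw).1.1.differentiableAt (by simp)).hasFDerivAt
  · rw [hsrc]
    exact ⟨hΘ.mem_toOpenPartialHomeomorph_source hΘ' (by simp), hzV⟩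

/-- A surjective linear map to `ℂᵐ` is completed by a map to `ℂˢ` to an injective map. -/
theorem exists_clm_prod_injective (D : Cn (s + m) →L[ℂ] Cn m) (hD : Function.Surjective D) :
    ∃ L : Cn (s + m) →L[ℂ] Cn s, ∀ v, L v = 0 → D v = 0 → v = 0 := by
  let K := LinearMap.ker D.toLinearMap
  have hK : Module.finrank ℂ K = Module.finrank ℂ (Cn s) := by
    have h1 := LinearMap.finrank_range_add_finrank_ker D.toLinearMap
    rw [LinearMap.range_eq_top.2 hD, finrank_top] at h1
    simp only [finrank_euclideanSpace, Fintype.card_fin] at h1 ⊢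
    change m + Module.finrank ℂ K = s + m at h1
    omega
  obtain ⟨P, hP⟩ := LinearMap.exists_leftInverse_of_injective K.subtype K.ker_subtype
  let e := LinearEquiv.ofFinrankEq K (Cn s) hK
  refine ⟨LinearMap.toContinuousLinearMap (e.toLinearMap ∘ₗ P), fun v h1 h2 => ?_⟩
  have h3 : P v = 0 := e.map_eq_zero_iff.1 h1
  have h4 : P v = ⟨v, h2⟩ := congrArg (fun L => L (⟨v, h2⟩ : K)) hP
  rw [h4] at h3
  exact congrArg Subtype.val h3

variable {X Y : Type*} [TopologicalSpace X] [ChartedSpace (Cn (s + m)) X]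
  [TopologicalSpace Y] [ChartedSpace (Cn m) Y] [IsManifold 𝓘(ℂ, Cn (s + m)) ω X]
  [IsManifold 𝓘(ℂ, Cn m) ω Y] {π : X → Y}

/-- Around every point there are holomorphic coordinates adapted to a submersion. -/
theorem IsFibration.exists_isAdapted (hπ : IsFibration (s := s) (m := m) π) (x : X) :
    ∃ (φ : OpenPartialHomeomorph X (Cn (s + m))) (χ : OpenPartialHomeomorph Y (Cn m)),
      IsAdapted π φ χ ∧ x ∈ φ.source := by
  let φ := chartAt (Cn (s + m)) x
  let χ := chartAt (Cn m) (π x)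
  have hφ : φ ∈ holoCharts (n := s + m) X := IsManifold.chart_mem_maximalAtlas x
  have hχ : χ ∈ holoCharts (n := m) Y := IsManifold.chart_mem_maximalAtlas (π x)
  have hx : x ∈ φ.source := mem_chart_source _ x
  have hz : φ x ∈ φ.target := φ.map_source hx
  have hxz : φ.symm (φ x) = x := φ.left_inv hx
  have hfz : π (φ.symm (φ x)) ∈ χ.source := by rw [hxz]; exact mem_chart_source _ (π x)
  have hψ := contDiffAt_localRep hπ.holomorphic hφ hχ hz hfz
  set ψ := localRep π φ χ with hψdef
  have hsurj : Function.Surjective (fderiv ℂ ψ (φ x)) := by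
    intro c
    obtain ⟨u, hu⟩ := hπ.submersive (φ.symm (φ x))
      (mfderiv 𝓘(ℂ, Cn m) 𝓘(ℂ, Cn m) χ.symm (ψ (φ x)) c : Cn m)
    obtain ⟨v, hv⟩ := mfderiv_symm_surjective hφ hz u
    refine ⟨v, mfderiv_symm_injective hχ (χ.map_source hfz) ?_⟩
    have := mfderiv_symm_fderiv_localRep hπ.holomorphic hφ hχ hz hfz v
    exact this.trans ((congrArg _ hv).trans hu)
  obtain ⟨L, hL⟩ := exists_clm_prod_injective (fderiv ℂ ψ (φ x)) hsurj
  have hψL : ContDiffAt ℂ ω (fun w => (L w, ψ w)) (φ x) := L.contDiff.contDiffAt.prodMk hψ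
  have hΘ : ContDiffAt ℂ ω (fun w => joinL s m (L w, ψ w)) (φ x) :=
    (joinL s m).contDiff.contDiffAt.comp (φ x) hψL
  have hΘ' : HasFDerivAt (fun w => joinL s m (L w, ψ w))
      ((joinL s m).comp (L.prod (fderiv ℂ ψ (φ x)))) (φ x) :=
    (joinL s m).hasFDerivAt.comp (φ x)
      (L.hasFDerivAt.prodMk (hψ.differentiableAt (by simp)).hasFDerivAt)
  have hinj : Function.Injective (fderiv ℂ (fun w => joinL s m (L w, ψ w)) (φ x)) := by
    rw [hΘ'.fderiv, injective_iff_map_eq_zero]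
    intro v hv
    obtain ⟨h1, h2⟩ := join_eq_zero_iff.1 (show join (L v) (fderiv ℂ ψ (φ x) v) = 0 from hv)
    exact hL v h1 h2
  obtain ⟨e, he, hze, heS, hcoe⟩ := exists_mem_contDiffGroupoid hΘ hinj
    (eventually_mem_source hπ.holomorphic.continuous hz hfz)
  refine ⟨φ.trans e, χ, ⟨trans_mem_holoCharts hφ he, hχ, ?_, ?_⟩, ?_⟩
  · intro y hy
    rw [OpenPartialHomeomorph.trans_source] at hy
    have := (heS hy.2).2
    rwa [φ.left_inv hy.1] at this
  · intro y hy
    rw [OpenPartialHomeomorph.trans_source] at hy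
    rw [OpenPartialHomeomorph.trans_apply, hcoe, joinL_apply, lastCoords_join, hψdef, localRep,
      φ.left_inv hy.1]
  · rw [OpenPartialHomeomorph.trans_source]
    exact ⟨hx, hze⟩

end AdaptedCharts

/-! ### Metrics inducing a family on the fibers -/

section FiberForms

variable {s m : ℕ} {X Y : Type*} [TopologicalSpace X] [ChartedSpace (Cn (s + m)) X]
  [TopologicalSpace Y] [ChartedSpace (Cn m) Y] [IsManifold 𝓘(ℂ, Cn (s + m)) ω X]
  [IsManifold 𝓘(ℂ, Cn m) ω Y] {π : X → Y} {φ : OpenPartialHomeomorph X (Cn (s + m))}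
  {χ : OpenPartialHomeomorph Y (Cn m)} {z : Cn (s + m)}

omit [IsManifold 𝓘(ℂ, Cn (s + m)) ω X] [IsManifold 𝓘(ℂ, Cn m) ω Y] in
theorem IsAdapted.localRep_eventuallyEq (h : IsAdapted π φ χ) (hz : z ∈ φ.target) :
    localRep π φ χ =ᶠ[nhds z] lastCoordsL s m := by
  filter_upwards [φ.open_target.mem_nhds hz] with w hw
  rw [localRep, h.last_eq _ (φ.map_target hw), φ.right_inv hw, lastCoordsL_apply]

omit [IsManifold 𝓘(ℂ, Cn (s + m)) ω X] [IsManifold 𝓘(ℂ, Cn m) ω Y] in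
/-- In adapted coordinates the vertical vectors are those with vanishing last coordinates. -/
theorem IsAdapted.mfderiv_symm_mem_vert_iff (h : IsAdapted π φ χ)
    (hπ : IsFibration (s := s) (m := m) π) (hz : z ∈ φ.target) (u : Cn (s + m)) :
    mfderiv 𝓘(ℂ, Cn (s + m)) 𝓘(ℂ, Cn (s + m)) φ.symm z u ∈ vert (s := s) (m := m) π (φ.symm z) ↔
      lastCoords s m u = 0 := by
  have hfz := h.maps _ (φ.map_target hz)
  have h1 := mfderiv_symm_fderiv_localRep hπ.holomorphic h.left_mem h.right_mem hz hfz u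
  rw [(h.localRep_eventuallyEq hz).fderiv_eq, ContinuousLinearMap.fderiv, lastCoordsL_apply] at h1
  constructor
  · intro h2
    refine mfderiv_symm_injective h.right_mem (χ.map_source hfz) ?_
    exact (h1.trans h2).trans (map_zero _).symm
  · intro h2
    rw [h2] at h1
    exact h1.symm.trans (map_zero _)

variable (G : FiberField (s := s) (m := m) π)

theorem fiberCoeff_sesqForm (h : IsAdapted π φ χ) (hz : z ∈ φ.target) (u v : Cn (s + m))
    (hu : lastCoords s m u = 0) (hv : lastCoords s m v = 0)
    (hu' : mfderiv 𝓘(ℂ, Cn (s + m)) 𝓘(ℂ, Cn (s + m)) φ.symm z u ∈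
      vert (s := s) (m := m) π (φ.symm z))
    (hv' : mfderiv 𝓘(ℂ, Cn (s + m)) 𝓘(ℂ, Cn (s + m)) φ.symm z v ∈
      vert (s := s) (m := m) π (φ.symm z)) :
    G (φ.symm z) ⟨_, hu'⟩ ⟨_, hv'⟩ =
      sesqForm (fiberCoeff G h z) (firstCoords s m u) (firstCoords s m v) := by
  have key (u : Cn (s + m)) (hu : lastCoords s m u = 0)
      (hu' : mfderiv 𝓘(ℂ, Cn (s + m)) 𝓘(ℂ, Cn (s + m)) φ.symm z u ∈
        vert (s := s) (m := m) π (φ.symm z)) :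
      (⟨_, hu'⟩ : vert (s := s) (m := m) π (φ.symm z)) = ∑ i : Fin s, firstCoords s m u i •
        ⟨coordVec φ z (Fin.castAdd m i), h.coordVec_mem hz i⟩ := by
    have h1 : u = ∑ i : Fin s, firstCoords s m u i • stdVec (Fin.castAdd m i) := by
      conv_lhs => rw [← sum_smul_stdVec u]
      have h2 (i : Fin m) : u (Fin.natAdd s i) • stdVec (Fin.natAdd s i) = (0 : Cn (s + m)) := by
        have : u (Fin.natAdd s i) = 0 := congrArg (fun w : Cn m => w i) hu
        rw [this, zero_smul]
      rw [Fin.sum_univ_add, Finset.sum_congr rfl fun i _ => h2 i, Finset.sum_const_zero, add_zero]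
      rfl
    let D : Cn (s + m) →ₗ[ℂ] TangentSpace 𝓘(ℂ, Cn (s + m)) (φ.symm z) :=
      (mfderiv 𝓘(ℂ, Cn (s + m)) 𝓘(ℂ, Cn (s + m)) φ.symm z).toLinearMap
    have h3 : D u = ∑ i : Fin s, firstCoords s m u i • coordVec φ z (Fin.castAdd m i) := by
      refine (congrArg D h1).trans ?_
      simp only [map_sum, map_smul]
      rfl
    apply Subtype.ext
    simp only [AddSubmonoidClass.coe_finsetSum, Submodule.coe_smul]
    exact h3
  rw [key u hu hu', key v hv hv']
  simp only [map_sum, map_smul, LinearMap.sum_apply, LinearMap.smul_apply, map_smulₛₗ, smul_eq_mul,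
    sesqForm, fiberCoeff, Matrix.of_apply, hz, dite_true]
  rw [Finset.sum_comm]
  refine Finset.sum_congr rfl fun i _ => ?_
  rw [Finset.mul_sum]
  exact Finset.sum_congr rfl fun j _ => by ring

variable {G}

theorem IsSmoothHermitianFamily.conj_fiberCoeff (hG : IsSmoothHermitianFamily G)
    (h : IsAdapted π φ χ) (z : Cn (s + m)) (i j : Fin s) :
    conj (fiberCoeff G h z i j) = fiberCoeff G h z j i := by
  by_cases hz : z ∈ φ.target
  · simp only [fiberCoeff, Matrix.of_apply, hz, dite_true, hG.conj_symm]
  · simp only [fiberCoeff, Matrix.of_apply, hz, dite_false, map_zero]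

theorem IsSmoothHermitianFamily.sesqForm_fiberCoeff_pos (hG : IsSmoothHermitianFamily G)
    (hπ : IsFibration (s := s) (m := m) π) (h : IsAdapted π φ χ) (hz : z ∈ φ.target) {w : Cn s}
    (hw : w ≠ 0) : 0 < (sesqForm (fiberCoeff G h z) w w).re := by
  have h1 : lastCoords s m (join w 0) = 0 := lastCoords_join w 0
  have h2 := (h.mfderiv_symm_mem_vert_iff hπ hz _).2 h1
  have h3 := fiberCoeff_sesqForm G h hz _ _ h1 h1 h2 h2
  have h4 : firstCoords s m (join w (0 : Cn m)) = w := by ext i; simp [firstCoords]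
  rw [h4] at h3
  rw [← h3]
  refine hG.pos _ _ fun h0 => hw ?_
  have h5 : mfderiv 𝓘(ℂ, Cn (s + m)) 𝓘(ℂ, Cn (s + m)) φ.symm z (join w (0 : Cn m)) = 0 :=
    congrArg Subtype.val h0
  exact (join_eq_zero_iff.1 (mfderiv_symm_injective h.left_mem hz (h5.trans (map_zero _).symm))).1

theorem contDiff_join_left (c : Cn m) : ContDiff ℂ ω fun w : Cn s => join w c :=
  (joinL s m).contDiff.comp (contDiff_id.prodMk contDiff_const)

/-- The metric on a fiber, in fiber coordinates. -/
theorem IsSmoothHermitianFamily.isHermMatrixOn (hG : IsSmoothHermitianFamily G)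
    (hπ : IsFibration (s := s) (m := m) π) (h : IsAdapted π φ χ) (c : Cn m) :
    IsHermMatrixOn (fun w => fiberCoeff G h (join w c)) {w | join w c ∈ φ.target} where
  isOpen := φ.open_target.preimage (contDiff_join_left c).continuous
  smooth i j := (hG.smooth φ χ h i j).comp
    (((contDiff_join_left c).restrict_scalars ℝ).of_le le_top).contDiffOn fun _ hw => hw
  conj_symm _ _ i j := hG.conj_fiberCoeff h _ i j
  pos _ hw _ hv := hG.sesqForm_fiberCoeff_pos hπ h hw hv

end FiberForms

section Extension

variable {s m : ℕ}

/-- The block diagonal matrix with blocks `A` and `1`. -/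
def blockOne (A : Matrix (Fin s) (Fin s) ℂ) : Matrix (Fin (s + m)) (Fin (s + m)) ℂ :=
  (Matrix.fromBlocks A 0 0 (1 : Matrix (Fin m) (Fin m) ℂ)).submatrix finSumFinEquiv.symm
    finSumFinEquiv.symm

theorem sesqForm_blockOne (A : Matrix (Fin s) (Fin s) ℂ) (u v : Cn (s + m)) :
    sesqForm (blockOne A) u v = sesqForm A (firstCoords s m u) (firstCoords s m v) +
      ∑ a, lastCoords s m u a * conj (lastCoords s m v a) := by
  simp [sesqForm, blockOne, Fin.sum_univ_add, firstCoords, lastCoords, Matrix.one_apply]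

/-- The sesquilinear form of a matrix, as a linear map. -/
def sesqFormL {n : ℕ} (A : Matrix (Fin n) (Fin n) ℂ) : Cn n →ₗ[ℂ] Cn n →ₗ⋆[ℂ] ℂ :=
  LinearMap.mk₂'ₛₗ (RingHom.id ℂ) (starRingEnd ℂ) (sesqForm A)
    (fun u u' v => by
      simp only [sesqForm, ← Finset.sum_add_distrib, PiLp.add_apply]
      exact Finset.sum_congr rfl fun i _ => Finset.sum_congr rfl fun j _ => by ring)
    (fun c u v => by
      simp only [sesqForm, smul_eq_mul, Finset.mul_sum, PiLp.smul_apply, RingHom.id_apply]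
      exact Finset.sum_congr rfl fun i _ => Finset.sum_congr rfl fun j _ => by ring)
    (fun u v v' => by
      simp only [sesqForm, ← Finset.sum_add_distrib, PiLp.add_apply, map_add]
      exact Finset.sum_congr rfl fun i _ => Finset.sum_congr rfl fun j _ => by ring)
    (fun c u v => by
      simp only [sesqForm, smul_eq_mul, Finset.mul_sum, PiLp.smul_apply, map_mul]
      exact Finset.sum_congr rfl fun i _ => Finset.sum_congr rfl fun j _ => by ring)

variable {X Y : Type*} [TopologicalSpace X] [ChartedSpace (Cn (s + m)) X]
  [TopologicalSpace Y] [ChartedSpace (Cn m) Y] [IsManifold 𝓘(ℂ, Cn (s + m)) ω X]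
  [IsManifold 𝓘(ℂ, Cn m) ω Y] {π : X → Y} {φ : OpenPartialHomeomorph X (Cn (s + m))}
  {χ : OpenPartialHomeomorph Y (Cn m)} {G : FiberField (s := s) (m := m) π}

/-- In the domain of adapted coordinates a family of metrics on the fibers is induced by a
Hermitian metric: one takes the direct sum with the flat metric of the base coordinates. -/
theorem IsSmoothHermitianFamily.exists_local_extension (hG : IsSmoothHermitianFamily G)
    (hπ : IsFibration (s := s) (m := m) π) (h : IsAdapted π φ χ) :
    ∃ Φ : SesqField (n := s + m) X, (∀ x u v, conj (Φ x u v) = Φ x v u) ∧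
      (∀ x ∈ φ.source, ∀ u, u ≠ 0 → 0 < (Φ x u u).re) ∧
      (∀ i j, ContDiffOn ℝ ∞ (fun z => coeff Φ φ z i j) φ.target) ∧
      ∀ x ∈ φ.source, ∀ u v : vert (s := s) (m := m) π x, Φ x u v = G x u v := by
  let B (z : Cn (s + m)) : Matrix (Fin (s + m)) (Fin (s + m)) ℂ := blockOne (fiberCoeff G h z)
  let D (x : X) : TangentSpace 𝓘(ℂ, Cn (s + m)) x →ₗ[ℂ] Cn (s + m) :=
    (mfderiv 𝓘(ℂ, Cn (s + m)) 𝓘(ℂ, Cn (s + m)) φ x).toLinearMap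
  let Φ : SesqField (n := s + m) X := fun x => ((sesqFormL (B (φ x))).compl₂ (D x)).comp (D x)
  have hΦ (x) (u v : TangentSpace 𝓘(ℂ, Cn (s + m)) x) :
      Φ x u v = sesqForm (B (φ x)) (D x u) (D x v) := rfl
  have hD (z) (hz : z ∈ φ.target) (u : Cn (s + m)) :
      D (φ.symm z) (mfderiv 𝓘(ℂ, Cn (s + m)) 𝓘(ℂ, Cn (s + m)) φ.symm z u) = u :=
    mfderiv_mfderiv_symm h.left_mem hz u
  have hΦz (z) (hz : z ∈ φ.target) (u v : Cn (s + m)) :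
      Φ (φ.symm z) (mfderiv 𝓘(ℂ, Cn (s + m)) 𝓘(ℂ, Cn (s + m)) φ.symm z u)
        (mfderiv 𝓘(ℂ, Cn (s + m)) 𝓘(ℂ, Cn (s + m)) φ.symm z v) = sesqForm (B z) u v := by
    rw [hΦ, hD z hz, hD z hz, φ.right_inv hz]
  refine ⟨Φ, fun x u v => ?_, fun x hx u hu => ?_, fun i j => ?_, fun x hx u v => ?_⟩
  · rw [hΦ, hΦ, sesqForm_blockOne, sesqForm_blockOne]
    simp only [sesqForm, map_add, map_sum, map_mul, Complex.conj_conj, hG.conj_fiberCoeff h]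
    congr 1
    · rw [Finset.sum_comm]
      exact Finset.sum_congr rfl fun i _ => Finset.sum_congr rfl fun j _ => by ring
    · exact Finset.sum_congr rfl fun j _ => by ring
  · obtain ⟨z, hz, rfl⟩ : ∃ z ∈ φ.target, φ.symm z = x := ⟨φ x, φ.map_source hx, φ.left_inv hx⟩
    obtain ⟨U, rfl⟩ : ∃ U : Cn (s + m),
      mfderiv 𝓘(ℂ, Cn (s + m)) 𝓘(ℂ, Cn (s + m)) φ.symm z U = u :=
        mfderiv_symm_surjective h.left_mem hz u
    have hU : U ≠ 0 := by
      rintro rfl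
      exact hu (map_zero _)
    have hsum : ∑ a, lastCoords s m U a * conj (lastCoords s m U a) =
        ((∑ a, Complex.normSq (lastCoords s m U a) : ℝ) : ℂ) := by
      push_cast
      exact Finset.sum_congr rfl fun a _ => Complex.mul_conj _
    rw [hΦz z hz, sesqForm_blockOne, hsum, Complex.add_re, Complex.ofReal_re]
    have hnn : ∀ a, 0 ≤ Complex.normSq (lastCoords s m U a) := fun a => Complex.normSq_nonneg _
    by_cases hw : firstCoords s m U = 0
    · have hl : lastCoords s m U ≠ 0 := fun hl => hU (by
        rw [← join_firstCoords_lastCoords U, join_eq_zero_iff]; exact ⟨hw, hl⟩)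
      obtain ⟨a, ha⟩ : ∃ a, lastCoords s m U a ≠ 0 := by
        by_contra! hcon
        exact hl (by ext a; exact hcon a)
      have h1 : 0 < ∑ a, Complex.normSq (lastCoords s m U a) :=
        Finset.sum_pos' (fun a _ => hnn a) ⟨a, Finset.mem_univ a, Complex.normSq_pos.2 ha⟩
      have h2 : sesqForm (fiberCoeff G h z) (firstCoords s m U) (firstCoords s m U) = 0 := by
        rw [hw]; simp [sesqForm]
      rw [h2]
      simpa using h1
    · exact add_pos_of_pos_of_nonneg (hG.sesqForm_fiberCoeff_pos hπ h hz hw)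
        (Finset.sum_nonneg fun a _ => hnn a)
  · have h1 : ContDiffOn ℝ ∞ (fun z => B z i j) φ.target := by
      simp only [B, blockOne, Matrix.submatrix_apply]
      rcases finSumFinEquiv.symm i with i | i <;> rcases finSumFinEquiv.symm j with j | j
      · exact hG.smooth φ χ h i j
      all_goals exact contDiffOn_const
    refine h1.congr fun z hz => ?_
    exact (hΦz z hz _ _).trans (sesqForm_stdVec _ _ _)
  · obtain ⟨z, hz, rfl⟩ : ∃ z ∈ φ.target, φ.symm z = x := ⟨φ x, φ.map_source hx, φ.left_inv hx⟩
    obtain ⟨u, hu⟩ := u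
    obtain ⟨v, hv⟩ := v
    obtain ⟨U, rfl⟩ : ∃ U : Cn (s + m),
      mfderiv 𝓘(ℂ, Cn (s + m)) 𝓘(ℂ, Cn (s + m)) φ.symm z U = u :=
        mfderiv_symm_surjective h.left_mem hz u
    obtain ⟨V, rfl⟩ : ∃ V : Cn (s + m),
      mfderiv 𝓘(ℂ, Cn (s + m)) 𝓘(ℂ, Cn (s + m)) φ.symm z V = v :=
        mfderiv_symm_surjective h.left_mem hz v
    have hU := (h.mfderiv_symm_mem_vert_iff hπ hz U).1 hu
    have hV := (h.mfderiv_symm_mem_vert_iff hπ hz V).1 hv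
    rw [fiberCoeff_sesqForm G h hz U V hU hV hu hv]
    refine (hΦz z hz U V).trans ?_
    rw [sesqForm_blockOne, hU]
    simp

end Extension

section RealStructure

variable {n : ℕ} {X : Type*} [TopologicalSpace X] [ChartedSpace (Cn n) X]

theorem contDiffGroupoid_complex_le_real :
    contDiffGroupoid ω 𝓘(ℂ, Cn n) ≤ contDiffGroupoid ∞ 𝓘(ℝ, Cn n) := by
  rw [contDiffGroupoid, contDiffGroupoid]
  refine groupoid_of_pregroupoid_le _ _ fun f t hf => ?_
  exact (ContDiffOn.restrict_scalars ℝ hf).of_le le_top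

/-- The real smooth structure of a complex manifold. -/
theorem isManifold_real [IsManifold 𝓘(ℂ, Cn n) ω X] : IsManifold 𝓘(ℝ, Cn n) ∞ X :=
  { toHasGroupoid := hasGroupoid_of_le (G₁ := contDiffGroupoid ω 𝓘(ℂ, Cn n)) inferInstance
      contDiffGroupoid_complex_le_real }

theorem holoCharts_subset_real :
    holoCharts (n := n) X ⊆ IsManifold.maximalAtlas 𝓘(ℝ, Cn n) ∞ X :=
  StructureGroupoid.maximalAtlas_mono contDiffGroupoid_complex_le_real

end RealStructure

section Gluing

variable {s m : ℕ} {X Y : Type*} [TopologicalSpace X] [ChartedSpace (Cn (s + m)) X]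
  [TopologicalSpace Y] [ChartedSpace (Cn m) Y] [IsManifold 𝓘(ℂ, Cn (s + m)) ω X]
  [IsManifold 𝓘(ℂ, Cn m) ω Y] {π : X → Y} {G : FiberField (s := s) (m := m) π}

/-- A smooth family of Hermitian metrics on the fibers is induced by a Hermitian metric on the total
space: local extensions are glued by a partition of unity. -/
theorem IsSmoothHermitianFamily.exists_isHermitianMetric_induces [T2Space X] [CompactSpace X]
    (hG : IsSmoothHermitianFamily G) (hπ : IsFibration (s := s) (m := m) π) :
    ∃ Φ : SesqField (n := s + m) X, IsHermitianMetric Φ ∧ Induces Φ G := by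
  classical
  have : IsManifold 𝓘(ℝ, Cn (s + m)) ∞ X := isManifold_real
  choose φ χ hadapt hmem using hπ.exists_isAdapted
  choose Ψ hconj hpos hsmooth hind using fun x => hG.exists_local_extension hπ (hadapt x)
  obtain ⟨t, ht⟩ := isCompact_univ.elim_finite_subcover (fun x => (φ x).source)
    (fun x => (φ x).open_source) fun x _ => Set.mem_iUnion.2 ⟨x, hmem x⟩
  obtain ⟨ρ, hρ⟩ := SmoothPartitionOfUnity.exists_isSubordinate 𝓘(ℝ, Cn (s + m))
    (isClosed_univ (X := X)) (fun k : t => (φ k).source) (fun k => (φ k).open_source)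
    fun x hx => by simpa using ht hx
  have hsum (x : X) : ∑ k, ρ k x = 1 := by
    rw [← finsum_eq_sum_of_fintype]
    exact ρ.sum_eq_one (Set.mem_univ x)
  have hρs {k : t} {x : X} (hx : ρ k x ≠ 0) : x ∈ (φ k).source :=
    hρ k (subset_tsupport _ hx)
  let Φ : SesqField (n := s + m) X := fun x => ∑ k : t, (ρ k x : ℂ) • Ψ k x
  have hΦ (x u v) : Φ x u v = ∑ k : t, (ρ k x : ℂ) * Ψ k x u v := by
    simp [Φ, LinearMap.sum_apply]
  refine ⟨Φ, ⟨fun x u v => ?_, fun x u hu => ?_, fun φ' hφ' i j => ?_⟩, fun x u v => ?_⟩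
  · rw [hΦ, hΦ, map_sum]
    exact Finset.sum_congr rfl fun k _ => by rw [map_mul, hconj, Complex.conj_ofReal]
  · rw [hΦ, Complex.re_sum]
    simp only [Complex.re_ofReal_mul]
    obtain ⟨k, hk⟩ : ∃ k, ρ k x ≠ 0 := by
      by_contra! hcon
      have := hsum x
      simp [hcon] at this
    refine Finset.sum_pos' (fun k _ => ?_) ⟨k, Finset.mem_univ k, ?_⟩
    · by_cases hk : ρ k x = 0
      · rw [hk, zero_mul]
      · exact mul_nonneg (ρ.nonneg k x) (hpos k x (hρs hk) u hu).le
    · exact mul_pos ((ρ.nonneg k x).lt_of_ne' hk) (hpos k x (hρs hk) u hu)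
  · intro z hz
    refine ContDiffAt.contDiffWithinAt ?_
    have hco (w) : coeff Φ φ' w i j =
        ∑ k : t, (ρ k (φ'.symm w) : ℂ) * coeff (Ψ k) φ' w i j := hΦ _ _ _
    simp only [hco]
    refine ContDiffAt.sum fun k _ => ?_
    by_cases hk : φ'.symm z ∈ (φ k).source
    · have h1 : ContDiffAt ℝ ∞ (fun w => ρ k (φ'.symm w)) z := by
        have h2 : ContMDiffAt 𝓘(ℝ, Cn (s + m)) 𝓘(ℝ, Cn (s + m)) ∞ φ'.symm z :=
          (contMDiffOn_symm_of_mem_maximalAtlas (holoCharts_subset_real hφ')).contMDiffAt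
            (φ'.open_target.mem_nhds hz)
        exact ((ρ k).contMDiff.contMDiffAt.comp z h2).contDiffAt
      refine (Complex.ofRealCLM.contDiff.contDiffAt.comp z h1).mul ?_
      have h3 : (fun w => coeff (Ψ k) φ' w i j) =ᶠ[nhds z] fun w =>
          sesqForm (coeff (Ψ k) (φ k) (localRep id φ' (φ k) w))
            (fderiv ℂ (localRep id φ' (φ k)) w (stdVec i))
            (fderiv ℂ (localRep id φ' (φ k)) w (stdVec j)) := by
        filter_upwards [eventually_mem_source (f := (id : X → X)) continuous_id hz hk] with w hw
        rw [← sesqForm_coeff_eq hφ' (hadapt k).left_mem hw.1 hw.2, sesqForm_stdVec]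
      refine ContDiffAt.congr_of_eventuallyEq ?_ h3
      refine contDiffAt_sesqForm_comp
        (contDiffAt_localRep contMDiff_id hφ' (hadapt k).left_mem hz hk) (fun a b => ?_) _ _
      exact (hsmooth k a b).contDiffAt
        ((φ k).open_target.mem_nhds ((φ k).map_source hk))
    · have h1 : φ'.symm z ∉ tsupport (ρ k) := fun h1 => hk (hρ k h1)
      have h2 : ∀ᶠ w in nhds z, φ'.symm w ∉ tsupport (ρ k) :=
        (φ'.continuousAt_symm hz).eventually ((isClosed_tsupport _).isOpen_compl.eventually_mem h1)
      have h3 : (fun w => (ρ k (φ'.symm w) : ℂ) * coeff (Ψ k) φ' w i j) =ᶠ[nhds z]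
          fun _ => 0 := by
        filter_upwards [h2] with w hw
        rw [image_eq_zero_of_notMem_tsupport hw, Complex.ofReal_zero, zero_mul]
      exact contDiffAt_const.congr_of_eventuallyEq h3
  · rw [hΦ]
    have h1 (k : t) : (ρ k x : ℂ) * Ψ k x u v = (ρ k x : ℂ) * G x u v := by
      by_cases hk : ρ k x = 0
      · rw [hk, Complex.ofReal_zero, zero_mul, zero_mul]
      · rw [hind k x (hρs hk)]
    simp only [h1]
    rw [← Finset.sum_mul, ← Complex.ofReal_sum, hsum, Complex.ofReal_one, one_mul]

end Gluing

/-! ### Curvature of warped products -/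

section Warped

variable {s m : ℕ} {X Y : Type*} [TopologicalSpace X] [ChartedSpace (Cn (s + m)) X]
  [TopologicalSpace Y] [ChartedSpace (Cn m) Y] [IsManifold 𝓘(ℂ, Cn (s + m)) ω X]
  [IsManifold 𝓘(ℂ, Cn m) ω Y] {π : X → Y} {φ : OpenPartialHomeomorph X (Cn (s + m))}
  {χ : OpenPartialHomeomorph Y (Cn m)} {z : Cn (s + m)}
  {Φ : SesqField (n := s + m) X} {ωY : SesqField (n := m) Y}

omit [IsManifold 𝓘(ℂ, Cn (s + m)) ω X] [IsManifold 𝓘(ℂ, Cn m) ω Y] in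
theorem warped_apply (r : ℝ) (x : X) (u v : TangentSpace 𝓘(ℂ, Cn (s + m)) x) :
    warped π Φ r ωY x u v = Φ x u v +
      r * ωY (π x) (dπ (s := s) (m := m) π x u) (dπ (s := s) (m := m) π x v) := rfl

omit [IsManifold 𝓘(ℂ, Cn (s + m)) ω X] [IsManifold 𝓘(ℂ, Cn m) ω Y] in
theorem sesqForm_coeff_warped (hπ : IsFibration (s := s) (m := m) π)
    (hφ : φ ∈ holoCharts (n := s + m) X) (hχ : χ ∈ holoCharts (n := m) Y) (hz : z ∈ φ.target)
    (hπz : π (φ.symm z) ∈ χ.source) (r : ℝ) (u v : Cn (s + m)) :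
    sesqForm (coeff (warped π Φ r ωY) φ z) u v = sesqForm (coeff Φ φ z) u v +
      r * sesqForm (coeff ωY χ (localRep π φ χ z)) (fderiv ℂ (localRep π φ χ) z u)
        (fderiv ℂ (localRep π φ χ) z v) := by
  rw [← apply_mfderiv_symm, ← apply_mfderiv_symm, warped_apply,
    ← apply_mfderiv_mfderiv hπ.holomorphic hφ hχ hz hπz]

omit [IsManifold 𝓘(ℂ, Cn (s + m)) ω X] in
theorem IsHermitianMetric.warped (hΦ : IsHermitianMetric Φ) (hωY : IsHermitianMetric ωY)
    (hπ : IsFibration (s := s) (m := m) π) {r : ℝ} (hr : 0 ≤ r) :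
    IsHermitianMetric (warped π Φ r ωY) where
  conj_symm x u v := by
    rw [warped_apply, warped_apply, map_add, map_mul, Complex.conj_ofReal, hΦ.conj_symm,
      hωY.conj_symm]
  pos x u hu := by
    rw [warped_apply, Complex.add_re, Complex.re_ofReal_mul]
    refine add_pos_of_pos_of_nonneg (hΦ.pos x u hu) (mul_nonneg hr ?_)
    by_cases h : dπ (s := s) (m := m) π x u = 0
    · simp [h]
    · exact (hωY.pos _ _ h).le
  smooth φ hφ i j z hz := by
    let χ := chartAt (Cn m) (π (φ.symm z))
    have hχ : χ ∈ holoCharts (n := m) Y := IsManifold.chart_mem_maximalAtlas _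
    have hπz : π (φ.symm z) ∈ χ.source := mem_chart_source _ _
    have h1 : (fun w => coeff (HermFib.warped π Φ r ωY) φ w i j) =ᶠ[nhds z] fun w =>
        coeff Φ φ w i j + r * sesqForm (coeff ωY χ (localRep π φ χ w))
          (fderiv ℂ (localRep π φ χ) w (stdVec i)) (fderiv ℂ (localRep π φ χ) w (stdVec j)) := by
      filter_upwards [eventually_mem_source hπ.holomorphic.continuous hz hπz] with w hw
      rw [← sesqForm_stdVec (coeff (HermFib.warped π Φ r ωY) φ w),
        sesqForm_coeff_warped hπ hφ hχ hw.1 hw.2, sesqForm_stdVec]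
    refine (ContDiffAt.congr_of_eventuallyEq ?_ h1).contDiffWithinAt
    refine ((hΦ.isHermMatrixOn hφ).contDiffAt hz i j).add (contDiffAt_const.mul ?_)
    exact contDiffAt_sesqForm_comp (contDiffAt_localRep hπ.holomorphic hφ hχ hz hπz)
      (fun a b => (hωY.isHermMatrixOn hχ).contDiffAt (χ.map_source hπz) a b) _ _

/-- The last coordinates of a tangent vector and of its base point. -/
def lastPair (s m : ℕ) : Cn (s + m) × Cn (s + m) →L[ℂ] Cn m × Cn m :=
  (lastCoordsL s m).prodMap (lastCoordsL s m)

omit [IsManifold 𝓘(ℂ, Cn (s + m)) ω X] [IsManifold 𝓘(ℂ, Cn m) ω Y] in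
theorem IsAdapted.lastCoords_mem (h : IsAdapted π φ χ) (hz : z ∈ φ.target) :
    lastCoords s m z ∈ χ.target := by
  have := χ.map_source (h.maps _ (φ.map_target hz))
  rwa [h.last_eq _ (φ.map_target hz), φ.right_inv hz] at this

omit [IsManifold 𝓘(ℂ, Cn (s + m)) ω X] [IsManifold 𝓘(ℂ, Cn m) ω Y] in
/-- In adapted coordinates the Levi form of a warped product splits. -/
theorem levi_warped (hπ : IsFibration (s := s) (m := m) π) (hΦ : IsHermitianMetric Φ)
    (hωY : IsHermitianMetric ωY) (h : IsAdapted π φ χ) (hz : z ∈ φ.target) (r : ℝ)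
    (v : Cn (s + m)) (w : Cn (s + m) × Cn (s + m)) :
    levi (quadForm (coeff (warped π Φ r ωY) φ)) (z, v) w =
      levi (quadForm (coeff Φ φ)) (z, v) w +
        r * levi (quadForm (coeff ωY χ)) (lastPair s m (z, v)) (lastPair s m w) := by
  have h1 : quadForm (coeff (warped π Φ r ωY) φ) =ᶠ[nhds (z, v)] fun p =>
      quadForm (coeff Φ φ) p + r * (quadForm (coeff ωY χ) ∘ lastPair s m) p := by
    filter_upwards [continuousAt_fst.eventually (φ.open_target.eventually_mem hz)] with p hp
    have h2 := sesqForm_coeff_warped (Φ := Φ) (ωY := ωY) hπ h.left_mem h.right_mem hp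
      (h.maps _ (φ.map_target hp)) r p.2 p.2
    rw [(h.localRep_eventuallyEq hp).fderiv_eq, ContinuousLinearMap.fderiv,
      (h.localRep_eventuallyEq hp).eq_of_nhds] at h2
    exact h2
  have h3 : ContDiffAt ℝ 2 (quadForm (coeff ωY χ)) (lastPair s m (z, v)) :=
    (hωY.isHermMatrixOn h.right_mem).contDiffAt_quadForm (h.lastCoords_mem hz) _
  have h4 : ContDiffAt ℂ 2 (lastPair s m) (z, v) := (lastPair s m).contDiff.contDiffAt
  have h5 : ContDiffAt ℝ 2 (quadForm (coeff ωY χ) ∘ lastPair s m) (z, v) :=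
    h3.comp _ (h4.restrict_scalars ℝ)
  rw [levi_congr h1, levi_add ((hΦ.isHermMatrixOn h.left_mem).contDiffAt_quadForm hz v)
    (contDiffAt_const.mul h5), levi_const_mul h5, levi_comp h3 h4, ContinuousLinearMap.fderiv]

variable {G : FiberField (s := s) (m := m) π}

/-- On vertical vectors, the Levi form of a metric that induces `G` is that of `G`. -/
theorem levi_fiber (hπ : IsFibration (s := s) (m := m) π) (hΦ : IsHermitianMetric Φ)
    (hΦG : Induces Φ G) (h : IsAdapted π φ χ) {w : Cn s} {c : Cn m} (hz : join w c ∈ φ.target)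
    (ξ η : Cn s) :
    levi (quadForm (coeff Φ φ)) (join w c, join ξ 0) (join ξ 0, join η 0) =
      levi (quadForm fun w' => fiberCoeff G h (join w' c)) (w, ξ) (ξ, η) := by
  let ι : Cn s × Cn s → Cn (s + m) × Cn (s + m) := fun p => (join p.1 c, join p.2 0)
  have hι : HasFDerivAt ι (((joinL s m).comp (ContinuousLinearMap.inl ℂ _ _)).prodMap
      ((joinL s m).comp (ContinuousLinearMap.inl ℂ _ _))) (w, ξ) := by
    have h1 (d : Cn m) (w : Cn s) : HasFDerivAt (fun w : Cn s => join w d)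
        ((joinL s m).comp (ContinuousLinearMap.inl ℂ _ _)) w :=
      (joinL s m).hasFDerivAt.comp w ((hasFDerivAt_id w).prodMk (hasFDerivAt_const d w))
    exact (h1 c w).prodMap (w, ξ) (h1 0 ξ)
  have hι2 : ContDiffAt ℂ 2 ι (w, ξ) := by
    refine ContDiff.contDiffAt (ContDiff.of_le (n := ω) ?_ le_top)
    exact ((contDiff_join_left c).comp contDiff_fst).prodMk
      ((contDiff_join_left 0).comp contDiff_snd)
  have h2 : (quadForm fun w' => fiberCoeff G h (join w' c)) =ᶠ[nhds (w, ξ)]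
      quadForm (coeff Φ φ) ∘ ι := by
    have hev : ∀ᶠ p : Cn s × Cn s in nhds (w, ξ), join p.1 c ∈ φ.target :=
      ((contDiff_join_left c).continuous.comp continuous_fst).continuousAt.eventually
        (φ.open_target.eventually_mem hz)
    filter_upwards [hev] with p hp
    have h3 : lastCoords s m (join p.2 0) = 0 := lastCoords_join p.2 0
    have h4 := (h.mfderiv_symm_mem_vert_iff hπ hp _).2 h3
    have h5 := fiberCoeff_sesqForm G h hp _ _ h3 h3 h4 h4
    have h6 : firstCoords s m (join p.2 (0 : Cn m)) = p.2 := by ext i; simp [firstCoords]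
    rw [h6, ← hΦG, apply_mfderiv_symm] at h5
    exact h5.symm
  have h3 : ContDiffAt ℝ 2 (quadForm (coeff Φ φ)) (ι (w, ξ)) :=
    (hΦ.isHermMatrixOn h.left_mem).contDiffAt_quadForm hz _
  rw [levi_congr h2, levi_comp h3 hι2, hι.fderiv]
  rfl

/-- If `b ≤ 0` and either `a` or `b` is negative at a point, then `a + r b` is negative near this
point for all large `r`. -/
theorem eventually_add_mul_neg {P : Type*} [TopologicalSpace P] {a b : P → ℝ} {p₀ : P}
    (ha : ContinuousAt a p₀) (hb : ContinuousAt b p₀) (hb0 : ∀ᶠ p in nhds p₀, b p ≤ 0)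
    (h : a p₀ < 0 ∨ b p₀ < 0) :
    ∀ᶠ q : ℝ × P in Filter.atTop ×ˢ nhds p₀, a q.2 + q.1 * b q.2 < 0 := by
  rcases h with h | h
  · have h1 : ∀ᶠ p in nhds p₀, a p < 0 := ha.eventually_lt continuousAt_const h
    filter_upwards [(Filter.eventually_ge_atTop (0 : ℝ)).prod_mk (h1.and hb0)] with q hq
    nlinarith [mul_nonpos_of_nonneg_of_nonpos hq.1 hq.2.2]
  · have h1 : ∀ᶠ p in nhds p₀, a p < a p₀ + 1 := ha.eventually_lt continuousAt_const (by linarith)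
    have h2 : ∀ᶠ p in nhds p₀, b p < b p₀ / 2 := hb.eventually_lt continuousAt_const (by linarith)
    filter_upwards [((Filter.eventually_ge_atTop (0 : ℝ)).and
      (Filter.eventually_ge_atTop ((a p₀ + 1) / (-(b p₀ / 2))))).prod_mk (h1.and h2)] with q hq
    obtain ⟨⟨hr, hr'⟩, hq1, hq2⟩ := hq
    rw [div_le_iff₀ (by linarith)] at hr'
    nlinarith [mul_le_mul_of_nonneg_left hq2.le hr]

/-- The local estimate: near a given non-zero tangent vector, the Levi form of the warped product
is negative on a suitable lift, for all large `r`. The base component of the lift is the geodesic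
acceleration for `ωY`, which keeps the contribution of `ωY` non-positive; the fiber component is
constant, chosen such that the contribution of `Φ` is negative if the given vector is vertical. -/
theorem eventually_exists_levi_neg (hπ : IsFibration (s := s) (m := m) π)
    (hΦ : IsHermitianMetric Φ) (hωY : IsHermitianMetric ωY) (hωY_pos : HasPosHSC ωY)
    (hG : IsSmoothHermitianFamily G) (hG_pos : FibersHavePosHSC G) (hΦG : Induces Φ G)
    (h : IsAdapted π φ χ) (hz : z ∈ φ.target) {ξ : Cn (s + m)} (hξ : ξ ≠ 0) :
    ∀ᶠ q : ℝ × (Cn (s + m) × Cn (s + m)) in Filter.atTop ×ˢ nhds (z, ξ),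
      ∃ η, (levi (quadForm (coeff (warped π Φ q.1 ωY) φ)) q.2 (q.2.2, η)).re < 0 := by
  have hω := hωY.isHermMatrixOn h.right_mem
  have hΦφ := hΦ.isHermMatrixOn h.left_mem
  obtain ⟨η₀, hη₀⟩ : ∃ η₀ : Cn s, lastCoords s m ξ = 0 →
      (levi (quadForm (coeff Φ φ)) (z, ξ) (ξ, join η₀ 0)).re < 0 := by
    by_cases hl : lastCoords s m ξ = 0
    · have hz' := join_firstCoords_lastCoords z
      have hξ' := join_firstCoords_lastCoords ξ
      rw [hl] at hξ'
      have hξ0 : firstCoords s m ξ ≠ 0 := fun h0 => hξ (by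
        rw [← hξ', join_eq_zero_iff]; exact ⟨h0, rfl⟩)
      have hmem : join (firstCoords s m z) (lastCoords s m z) ∈ φ.target := hz'.symm ▸ hz
      obtain ⟨η₀, hη₀⟩ := ((hG.isHermMatrixOn hπ h (lastCoords s m z)).holSectCurv_pos_iff_exists
        hmem hξ0).1 (hG_pos φ χ h _ _ hmem _ hξ0)
      refine ⟨η₀, fun _ => ?_⟩
      rwa [← levi_fiber hπ hΦ hΦG h hmem, hz', hξ'] at hη₀
    · exact ⟨0, fun h0 => absurd h0 hl⟩
  let β (p : Cn (s + m) × Cn (s + m)) : Cn m :=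
    geodesicAccel (coeff ωY χ) (lastCoords s m p.1) (lastCoords s m p.2)
  let a (p : Cn (s + m) × Cn (s + m)) : ℝ :=
    (levi (quadForm (coeff Φ φ)) p (p.2, join η₀ (β p))).re
  let b (p : Cn (s + m) × Cn (s + m)) : ℝ :=
    (levi (quadForm (coeff ωY χ)) (lastPair s m p) (lastCoords s m p.2, β p)).re
  have hβ : ContinuousAt β (z, ξ) :=
    ContinuousAt.comp (g := fun p : Cn m × Cn m => geodesicAccel (coeff ωY χ) p.1 p.2)
      (f := lastPair s m) (x := (z, ξ))
      (hω.continuousAt_geodesicAccel (h.lastCoords_mem hz) (lastCoords s m ξ))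
      (lastPair s m).continuous.continuousAt
  have ha : ContinuousAt a (z, ξ) :=
    continuousAt_re_levi (f := id) (hΦφ.contDiffAt_quadForm hz ξ) continuousAt_id
      (continuousAt_snd.prodMk
        ((joinL s m).continuous.continuousAt.comp (continuousAt_const.prodMk hβ)))
  have hb : ContinuousAt b (z, ξ) :=
    continuousAt_re_levi (f := lastPair s m) (hω.contDiffAt_quadForm (h.lastCoords_mem hz) _)
      (lastPair s m).continuous.continuousAt
      (((lastCoordsL s m).continuous.comp continuous_snd).continuousAt.prodMk hβ)
  have hbneg (p : Cn (s + m) × Cn (s + m)) (hp : p.1 ∈ φ.target) (hp2 : lastCoords s m p.2 ≠ 0) :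
      b p < 0 :=
    hω.levi_geodesicAccel_neg (h.lastCoords_mem hp) hp2
      (hωY_pos χ h.right_mem _ (h.lastCoords_mem hp) _ hp2)
  have htarget : ∀ᶠ p : Cn (s + m) × Cn (s + m) in nhds (z, ξ), p.1 ∈ φ.target :=
    continuousAt_fst.eventually (φ.open_target.eventually_mem hz)
  have hb0 : ∀ᶠ p in nhds (z, ξ), b p ≤ 0 := by
    filter_upwards [htarget] with p hp
    by_cases hp2 : lastCoords s m p.2 = 0
    · have : (lastCoords s m p.2, β p) = 0 := by
        simp only [β, hp2, geodesicAccel_zero]; rfl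
      simp only [b, this, levi, map_zero, smul_zero, add_zero, zero_div, Complex.zero_re, le_refl]
    · exact (hbneg p hp hp2).le
  have hab : a (z, ξ) < 0 ∨ b (z, ξ) < 0 := by
    by_cases hl : lastCoords s m ξ = 0
    · left
      have hβ0 : β (z, ξ) = 0 := by simp only [β, hl, geodesicAccel_zero]
      simp only [a, hβ0]
      exact hη₀ hl
    · exact Or.inr (hbneg _ hz hl)
  filter_upwards [eventually_add_mul_neg ha hb hb0 hab, htarget.prod_inr Filter.atTop] with q hq hq'
  refine ⟨join η₀ (β q.2), ?_⟩
  have h1 : lastPair s m (q.2.2, join η₀ (β q.2)) = (lastCoords s m q.2.2, β q.2) :=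
    Prod.ext rfl (lastCoords_join _ _)
  have h2 := levi_warped hπ hΦ hωY h (z := q.2.1) hq' q.1 q.2.2 (q.2.2, join η₀ (β q.2))
  rw [h1] at h2
  rw [show q.2 = (q.2.1, q.2.2) from rfl, h2, Complex.add_re, Complex.re_ofReal_mul]
  exact hq

/-- A property that holds eventually near each point of a compact set holds eventually, uniformly on
the set. -/
theorem eventually_forall_mem_of_isCompact {A B : Type*} [TopologicalSpace B] {l : Filter A}
    {K : Set B} (hK : IsCompact K) {P : A → B → Prop}
    (h : ∀ y ∈ K, ∀ᶠ q : A × B in l ×ˢ nhds y, P q.1 q.2) : ∀ᶠ x in l, ∀ y ∈ K, P x y := by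
  obtain ⟨t₁, h₁, t₂, h₂, ht⟩ := Filter.mem_prod_iff.1
    (hK.mem_prod_nhdsSet_of_forall (s := {q | P q.1 q.2}) h)
  filter_upwards [h₁] with x hx y hy
  exact ht (Set.mk_mem_prod hx (subset_of_mem_nhdsSet h₂ hy))

/-- By homogeneity it suffices to consider unit vectors, which form a compact set; so at all points
near a given one the warped product has positive curvature in all directions, for all large `r`. -/
theorem eventually_forall_holSectCurv_pos (hπ : IsFibration (s := s) (m := m) π)
    (hΦ : IsHermitianMetric Φ) (hωY : IsHermitianMetric ωY) (hωY_pos : HasPosHSC ωY)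
    (hG : IsSmoothHermitianFamily G) (hG_pos : FibersHavePosHSC G) (hΦG : Induces Φ G)
    (h : IsAdapted π φ χ) (hz : z ∈ φ.target) :
    ∀ᶠ q : ℝ × Cn (s + m) in Filter.atTop ×ˢ nhds z, ∀ ξ : Cn (s + m), ξ ≠ 0 →
      0 < holSectCurv (coeff (warped π Φ q.1 ωY) φ) q.2 ξ := by
  have h1 : ∀ᶠ q : ℝ × Cn (s + m) in Filter.atTop ×ˢ nhds z,
      ∀ ξ ∈ Metric.sphere (0 : Cn (s + m)) 1,
        ∃ η, (levi (quadForm (coeff (warped π Φ q.1 ωY) φ)) (q.2, ξ) (ξ, η)).re < 0 := by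
    refine eventually_forall_mem_of_isCompact (isCompact_sphere _ _) fun ξ hξ => ?_
    have hξ0 : ξ ≠ 0 := Metric.ne_of_mem_sphere hξ one_ne_zero
    have h2 := eventually_exists_levi_neg hπ hΦ hωY hωY_pos hG hG_pos hΦG h hz hξ0
    rw [nhds_prod_eq] at h2
    exact Filter.tendsto_prodAssoc.eventually h2
  have h2 : ∀ᶠ q : ℝ × Cn (s + m) in Filter.atTop ×ˢ nhds z, 0 ≤ q.1 ∧ q.2 ∈ φ.target :=
    (Filter.eventually_ge_atTop (0 : ℝ)).prod_mk (φ.open_target.eventually_mem hz)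
  filter_upwards [h1, h2] with q hq hq' ξ hξ
  have hW := (hΦ.warped hωY hπ hq'.1).isHermMatrixOn h.left_mem
  have hc : ((‖ξ‖⁻¹ : ℝ) : ℂ) ≠ 0 := by simpa using hξ
  rw [← holSectCurv_smul _ _ ξ hc, hW.holSectCurv_pos_iff_exists hq'.2 (smul_ne_zero hc hξ)]
  refine hq _ ?_
  rw [mem_sphere_zero_iff_norm, norm_smul, Complex.norm_real, norm_inv, norm_norm,
    inv_mul_cancel₀ (norm_ne_zero_iff.2 hξ)]

/-- On a compact total space the warped products `Φ + r π^* ωY` have positive holomorphic sectional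
curvature for all large `r`. -/
theorem eventually_warped_hasPosHSC [CompactSpace X] (hπ : IsFibration (s := s) (m := m) π)
    (hΦ : IsHermitianMetric Φ) (hωY : IsHermitianMetric ωY) (hωY_pos : HasPosHSC ωY)
    (hG : IsSmoothHermitianFamily G) (hG_pos : FibersHavePosHSC G) (hΦG : Induces Φ G) :
    ∀ᶠ r : ℝ in Filter.atTop, HasPosHSC (warped π Φ r ωY) := by
  have h1 : ∀ᶠ r : ℝ in Filter.atTop, ∀ x ∈ (Set.univ : Set X),
      ∀ φ' ∈ holoCharts (n := s + m) X, ∀ z' ∈ φ'.target, φ'.symm z' = x →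
        ∀ ξ : Cn (s + m), ξ ≠ 0 → 0 < holSectCurv (coeff (warped π Φ r ωY) φ') z' ξ := by
    refine eventually_forall_mem_of_isCompact isCompact_univ fun x _ => ?_
    obtain ⟨φ, χ, h, hx⟩ := hπ.exists_isAdapted x
    have h2 : Filter.Tendsto (fun q : ℝ × X => (q.1, φ q.2)) (Filter.atTop ×ˢ nhds x)
        (Filter.atTop ×ˢ nhds (φ x)) :=
      Filter.tendsto_id.prodMap (φ.continuousAt hx)
    have h3 : ∀ᶠ q : ℝ × X in Filter.atTop ×ˢ nhds x, 0 ≤ q.1 ∧ q.2 ∈ φ.source :=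
      (Filter.eventually_ge_atTop (0 : ℝ)).prod_mk (φ.open_source.eventually_mem hx)
    filter_upwards [h2.eventually (eventually_forall_holSectCurv_pos hπ hΦ hωY hωY_pos hG hG_pos hΦG
      h (φ.map_source hx)), h3] with q hq hq' φ' hφ' z' hz' hzq ξ hξ
    have h4 : φ.symm (φ q.2) = q.2 := φ.left_inv hq'.2
    have h5 := (hΦ.warped hωY hπ hq'.1).holSectCurv_pos_of_chart h.left_mem hφ'
      (φ.map_source hq'.2) (by rw [h4, ← hzq]; exact φ'.map_target hz') hq hξ
    have h6 : localRep id φ φ' (φ q.2) = z' := by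
      change φ' (φ.symm (φ q.2)) = z'
      rw [h4, ← hzq, φ'.right_inv hz']
    rwa [h6] at h5
  filter_upwards [h1] with r hr φ' hφ' z' hz' ξ hξ
  exact hr _ (Set.mem_univ _) φ' hφ' z' hz' rfl ξ hξ

end Warped

end HermFib

end

theorem theorem1p1 {s m : ℕ} {X Y : Type*}
    [TopologicalSpace X] [T2Space X] [CompactSpace X]
    [ChartedSpace (HermFib.Cn (s + m)) X] [IsManifold 𝓘(ℂ, HermFib.Cn (s + m)) ω X]
    [TopologicalSpace Y] [T2Space Y]
    [ChartedSpace (HermFib.Cn m) Y] [IsManifold 𝓘(ℂ, HermFib.Cn m) ω Y]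
    (π : X → Y) (hπ : HermFib.IsFibration (s := s) (m := m) π)
    (ωY : HermFib.SesqField (n := m) Y)
    (hωY : HermFib.IsHermitianMetric ωY) (hωY_pos : HermFib.HasPosHSC ωY)
    (G : HermFib.FiberField (s := s) (m := m) π)
    (hG : HermFib.IsSmoothHermitianFamily G) (hG_pos : HermFib.FibersHavePosHSC G) :
    (∃ g : HermFib.SesqField (n := s + m) X,
      HermFib.IsHermitianMetric g ∧ HermFib.HasPosHSC g) ∧
    (∃ Φ : HermFib.SesqField (n := s + m) X,
      HermFib.IsHermitianMetric Φ ∧ HermFib.Induces Φ G) ∧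
    (∀ Φ : HermFib.SesqField (n := s + m) X,
      HermFib.IsHermitianMetric Φ → HermFib.Induces Φ G →
      ∃ r₀ : ℝ, ∀ r : ℝ, r₀ ≤ r →
        HermFib.IsHermitianMetric (HermFib.warped π Φ r ωY) ∧
        HermFib.HasPosHSC (HermFib.warped π Φ r ωY)) := by
  have hex := hG.exists_isHermitianMetric_induces hπ
  have hall (Φ : HermFib.SesqField (n := s + m) X) (hΦ : HermFib.IsHermitianMetric Φ)
      (hΦG : HermFib.Induces Φ G) : ∃ r₀ : ℝ, ∀ r : ℝ, r₀ ≤ r →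
        HermFib.IsHermitianMetric (HermFib.warped π Φ r ωY) ∧
        HermFib.HasPosHSC (HermFib.warped π Φ r ωY) := by
    refine Filter.eventually_atTop.1 ?_
    filter_upwards [Filter.eventually_ge_atTop (0 : ℝ),
      HermFib.eventually_warped_hasPosHSC hπ hΦ hωY hωY_pos hG hG_pos hΦG] with r hr hr'
    exact ⟨hΦ.warped hωY hπ hr, hr'⟩
  refine ⟨?_, hex, hall⟩
  obtain ⟨Φ, hΦ, hΦG⟩ := hex
  obtain ⟨r₀, hr₀⟩ := hall Φ hΦ hΦG
  exact ⟨_, hr₀ r₀ le_rfl⟩
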